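/- **Setting (Monotone bandits with $M$ players and plays of variable duration).** There are $n$ arms and $M\ge 1$ players; time is discrete. Arm $i$ has a finite nonempty state set $\mathcal S_i$. For $k\in\mathcal S_i$ there are given a reward $r^i_k\ge 0$, a duration $L^i_k\in\{1,2,\dots\}$, numbers $q^i(k,j)\ge 0$ with $\sum_{j\ne k}q^i(k,j)\le 1$, and a nondecreasing function $f^i_k:\{1,2,\dots\}\to[0,1]$ that is piecewise linear with a finite set $\mathcal W^i_k\ni 1$ of positive integer breakpoints (linear between consecutive breakpoints, constant from the last one on). For each $i$ the directed graph on $\mathcal S_i$ with an edge $(j,k)$ whenever $q^i(j,k)>0$ is strongly connected. At every step each free player may begin to play an arm that is not being played. A play of arm $i$ begun in state $k$ earns $r^i_k$ once, at its beginning, and occupies the player and the arm for $L^i_k$ steps; if it began $t\ge 1$ steps after the end of the previous play of the arm, then at its end the arm moves to $j\ne k$ with probability $q^i(k,j)f^i_k(t)$ and otherwise stays in $k$, independently for different arms. Arms that are not played keep their state and earn nothing. Policies may be randomized and history-dependent. At the start all arms are idle with $t=1$, and their states are chosen by the policy. $R_T$ denotes the total reward of the first $T$ steps. **Balanced LP.**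 For real variables $\lambda$, $h_i$, $p^i_k$ put $\Delta P^i_k=\sum_{j\ne k}q^i(k,j)(p^i_j-p^i_k)$. (Balance) is: minimize $M\lambda+\sum_i h_i$ subject to $L^i_k(\lambda+h_i)+(t-1)h_i\ge r^i_k+f^i_k(t)\Delta P^i_k$ for all $i$, $k\in\mathcal S_i$, $t\in\mathcal W^i_k$; $\;M\lambda=\sum_i h_i$; $\;\lambda,h_i\ge 0$. **BalancedIndex policy.** Fix an optimal solution of (Balance). Let $U_1$ be the set of arms $i$ such that playing $i$ over and over from some start state gives average reward at least $\lambda+h_i$ per step, and let $U_2$ be the set of arms $i\notin U_1$ with $h_i>0$. For $i\in U_2$, a state $k$ is *good* if $\Delta P^i_k<0$; an arm $i\in U_2$ in a state $k$ with $\Delta P^i_k\ge 0$ whose last play ended $t$ steps ago is *ready* if $t\ge t^i_k$, where $t^i_k$ is the smallest $t\in\mathcal W^i_k$ for which the constraint for $i,k,t$ is tight. The policy continuously plays $\min(M,|U_1|)$ fixed arms of $U_1$, each begun in a start state as above. If $|U_1|<M$, it starts with at most $M-|U_1|$ arms of $U_2$ in good states, and the remaining free players at each step choose among the arms of $U_2$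 that are not being played: first arms in good states; if none is left, ready arms; if none is left either, they idle. No other arm is played. Ties are broken arbitrarily. **Theorem.** (Balance) has an optimal solution. For every optimal solution there is a BalancedIndex policy, and every BalancedIndex policy is a 2-approximation: its reward satisfies $$2\,\liminf_{T\to\infty}\frac{\mathbb E[R_T]}{T}\;\ge\;\limsup_{T\to\infty}\frac{\mathbb E[R'_T]}{T}$$ for the reward $R'_T$ of any policy from any start states. Moreover $2\liminf_{T\to\infty}\mathbb E[R_T]/T$ is at least the optimal value of Whittle's linear program: maximize $\sum_{i}\sum_{k\in\mathcal S_i}\sum_{t\ge1}r^i_kx^i_{kt}$ subject to $x\ge 0$, $\sum_{i,k,t}L^i_kx^i_{kt}\le M$, $\sum_{k,t}(t+L^i_k-1)x^i_{kt}\le 1$ for all $i$, and $\sum_{j\ne k}\sum_t x^i_{kt}q^i(k,j)f^i_k(t)=\sum_{j\ne k}\sum_t x^i_{jt}q^i(j,k)f^i_j(t)$ for all $i$ and $k\in\mathcal S_i$. -/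

import Mathlib

open Filter

noncomputable section

/-- A Monotone bandit with `n` arms, `M` players and plays of variable duration.
Arm `i` has the states `Fin (K i)`.  Only the values `f i k t` with `t ≥ 1` and the
off-diagonal entries of `q i` are relevant. -/
structure MonotoneBandit (n : ℕ) (K : Fin n → ℕ) where
  /-- number of players -/
  M : ℕ
  M_pos : 1 ≤ M
  K_pos : ∀ i, 1 ≤ K i
  /-- reward for a play of arm `i` in state `k` -/
  r : ∀ i, Fin (K i) → ℝ
  r_nonneg : ∀ i k, 0 ≤ r i k
  /-- number of steps for which a play of arm `i` in state `k` blocks the player -/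
  L : ∀ i, Fin (K i) → ℕ
  L_pos : ∀ i k, 1 ≤ L i k
  /-- distribution of the new state, conditioned on the escape from the old one -/
  q : ∀ i, Fin (K i) → Fin (K i) → ℝ
  q_nonneg : ∀ i k j, 0 ≤ q i k j
  q_sum_le : ∀ i k, ∑ j with j ≠ k, q i k j ≤ 1
  /-- the directed graph of the positive entries of `q i` is strongly connected -/
  q_connected : ∀ i k j, Relation.ReflTransGen (fun a b => 0 < q i a b) k j
  /-- escape probability from state `k` when the last play ended `t` steps ago -/
  f : ∀ i, Fin (K i) → ℕ → ℝ
  f_nonneg : ∀ i k t, 1 ≤ t → 0 ≤ f i k t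
  f_le_one : ∀ i k t, 1 ≤ t → f i k t ≤ 1
  f_mono : ∀ i k t, 1 ≤ t → f i k t ≤ f i k (t + 1)
  /-- the finite set of breakpoints of the piecewise linear function `f i k` -/
  W : ∀ i, Fin (K i) → Finset ℕ
  W_pos : ∀ i k, ∀ t ∈ W i k, 1 ≤ t
  one_mem_W : ∀ i k, 1 ∈ W i k
  /-- `f i k` is linear between two consecutive breakpoints -/
  f_interp : ∀ i k, ∀ t₁ ∈ W i k, ∀ t₂ ∈ W i k, t₁ < t₂ →
    (∀ s ∈ W i k, ¬ (t₁ < s ∧ s < t₂)) → ∀ t, t₁ ≤ t → t ≤ t₂ →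
      f i k t = (((t₂ : ℝ) - t) * f i k t₁ + ((t : ℝ) - t₁) * f i k t₂) / ((t₂ : ℝ) - t₁)
  /-- `f i k` is constant from the last breakpoint on -/
  f_tail : ∀ i k, ∀ t₁ ∈ W i k, (∀ s ∈ W i k, s ≤ t₁) → ∀ t, t₁ ≤ t → f i k t = f i k t₁

/-- Situation of one arm at the beginning of a time step.  If `rem = 0` the arm is idle
(not being played), and its previous play ended `elapsed ≥ 1` steps ago.  If `rem ≥ 1` the arm
is blocked by a running play that occupies it for `rem` more steps (including the coming one),
and that began when the previous play had ended `elapsed` steps before. -/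
structure ArmStatus (m : ℕ) where
  state : Fin m
  elapsed : ℕ
  rem : ℕ

/-- Joint situation of all arms at the beginning of a time step. -/
abbrev BanditConfig {n : ℕ} (K : Fin n → ℕ) : Type := ∀ i, ArmStatus (K i)

/-- The past: situations and actions (sets of arms on which a play was begun), latest first. -/
abbrev BanditHistory {n : ℕ} (K : Fin n → ℕ) : Type := List (BanditConfig K × Finset (Fin n))

/-- Variables of the balanced linear program. -/
structure DualSolution {n : ℕ} (K : Fin n → ℕ) where
  lam : ℝ
  h : Fin n → ℝ
  p : ∀ i, Fin (K i) → ℝ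

namespace MonotoneBandit

variable {n : ℕ} {K : Fin n → ℕ} (B : MonotoneBandit n K)

/-! ### The controlled process -/

/-- Probability that arm `i` is in state `j` at the end of a play in state `k` that began when
the previous play had ended `t` steps before. -/
def trans (i : Fin n) (k : Fin (K i)) (t : ℕ) (j : Fin (K i)) : ℝ :=
  if j = k then 1 - ∑ l with l ≠ k, q B i k l * f B i k t else q B i k j * f B i k t

/-- Number of steps (including the coming one) for which the arm is occupied, once it has been
decided whether a play of the arm is begun now. -/
def occupied (i : Fin n) (c : ArmStatus (K i)) (play : Prop) [Decidable play] : ℕ :=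
  if c.rem = 0 then (if play then B.L i c.state else 0) else c.rem

/-- Probability that the state of arm `i` after the coming step is `j`: a transition happens
exactly if a play ends with this step. -/
def armProb (i : Fin n) (c : ArmStatus (K i)) (play : Prop) [Decidable play]
    (j : Fin (K i)) : ℝ :=
  if B.occupied i c play = 1 then B.trans i c.state c.elapsed j
  else if j = c.state then 1 else 0

/-- Situation of arm `i` after the coming step, if its state is then `j`. -/
def armNext (i : Fin n) (c : ArmStatus (K i)) (play : Prop) [Decidable play]
    (j : Fin (K i)) : ArmStatus (K i) :=
  if B.occupied i c play = 0 then ⟨c.state, c.elapsed + 1, 0⟩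
  else if B.occupied i c play = 1 then ⟨j, 1, 0⟩
  else ⟨c.state, c.elapsed, B.occupied i c play - 1⟩

/-- Joint situation after the coming step if plays are begun on the arms in `a` and the new
states are `s`. -/
def next (c : BanditConfig K) (a : Finset (Fin n)) (s : ∀ i, Fin (K i)) : BanditConfig K :=
  fun i => B.armNext i (c i) (i ∈ a) (s i)

/-- The arms evolve independently. -/
def jointProb (c : BanditConfig K) (a : Finset (Fin n)) (s : ∀ i, Fin (K i)) : ℝ :=
  ∏ i, B.armProb i (c i) (i ∈ a) (s i)

/-- A play earns its reward when it begins. -/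
def reward (c : BanditConfig K) (a : Finset (Fin n)) : ℝ :=
  ∑ i ∈ a, B.r i (c i).state

/-- The arms on which a play is running. -/
def busy (c : BanditConfig K) : Finset (Fin n) :=
  Finset.univ.filter fun i => (c i).rem ≠ 0

/-- Plays may be begun on idle arms only, and on at most as many as there are free players. -/
def Legal (c : BanditConfig K) (a : Finset (Fin n)) : Prop :=
  (∀ i ∈ a, (c i).rem = 0) ∧ a.card ≤ B.M - (busy c).card

/-- A history-dependent, randomized policy: the distribution of the set of arms on which plays
are begun, given the past and the present situation. -/
structure Policy where
  law : BanditHistory K → BanditConfig K → PMF (Finset (Fin n))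
  legal : ∀ H c a, law H c a ≠ 0 → B.Legal c a

/-- At the start all arms are idle, in the chosen states. -/
def start (s : ∀ i, Fin (K i)) : BanditConfig K := fun i => ⟨s i, 1, 0⟩

variable {B}

/-- Expected total reward of the next `T` steps, given the past `H` and the present situation
`c` (by the law of total expectation over the action and the new states). -/
def Policy.value (π : B.Policy) : ℕ → BanditHistory K → BanditConfig K → ℝ
  | 0, _, _ => 0
  | T + 1, H, c => ∑ a : Finset (Fin n), (π.law H c a).toReal *
      (B.reward c a +
        ∑ s : (∀ i, Fin (K i)), B.jointProb c a s * π.value T ((c, a) :: H) (B.next c a s))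

/-- Expected average reward per step in the first `T` steps, from the start states `s`. -/
def Policy.average (π : B.Policy) (s : ∀ i, Fin (K i)) (T : ℕ) : ℝ :=
  π.value T [] (start s) / T

/-- The pasts and situations that occur with positive probability. -/
inductive Policy.Reachable (π : B.Policy) (s : ∀ i, Fin (K i)) :
    BanditHistory K → BanditConfig K → Prop
  | init : Policy.Reachable π s [] (start s)
  | step (H : BanditHistory K) (c : BanditConfig K) (a : Finset (Fin n))
      (s' : ∀ i, Fin (K i)) : Policy.Reachable π s H c → π.law H c a ≠ 0 →
      0 < B.jointProb c a s' → Policy.Reachable π s ((c, a) :: H) (B.next c a s')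

variable (B)

/-! ### The linear programs -/

/-- Expected change of the potential `p` at an escape from state `k` of arm `i`. -/
def deltaP (D : DualSolution K) (i : Fin n) (k : Fin (K i)) : ℝ :=
  ∑ j with j ≠ k, B.q i k j * (D.p i j - D.p i k)

/-- Feasibility for the balanced linear program. -/
structure BalanceFeasible (D : DualSolution K) : Prop where
  main : ∀ i k, ∀ t ∈ B.W i k,
    B.r i k + B.f i k t * B.deltaP D i k ≤
      (B.L i k : ℝ) * (D.lam + D.h i) + ((t : ℝ) - 1) * D.h i
  balance : (B.M : ℝ) * D.lam = ∑ i, D.h i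
  lam_nonneg : 0 ≤ D.lam
  h_nonneg : ∀ i, 0 ≤ D.h i

/-- Objective of the balanced linear program. -/
def balanceObj (D : DualSolution K) : ℝ := (B.M : ℝ) * D.lam + ∑ i, D.h i

/-- Optimal solutions of the balanced linear program (a minimization). -/
def BalanceOptimal (D : DualSolution K) : Prop :=
  B.BalanceFeasible D ∧ ∀ D', B.BalanceFeasible D' → B.balanceObj D ≤ B.balanceObj D'

/-- Feasibility for Whittle's linear program, with variables `x i k t`, `t ≥ 1`; the variables
`x i k 0` are dummies with value `0`.  For `x ≥ 0`, the summability expresses that the left side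
of `idle` is finite, and it implies that all the series below converge. -/
structure WhittleFeasible (x : ∀ i, Fin (K i) → ℕ → ℝ) : Prop where
  nonneg : ∀ i k t, 0 ≤ x i k t
  zero : ∀ i k, x i k 0 = 0
  summable : ∀ i k, Summable fun t : ℕ => (t : ℝ) * x i k t
  players : ∑ i, ∑ k, ∑' t : ℕ, (B.L i k : ℝ) * x i k t ≤ B.M
  idle : ∀ i, ∑ k, ∑' t : ℕ, ((t : ℝ) + B.L i k - 1) * x i k t ≤ 1
  flow : ∀ i k,
    ∑ j with j ≠ k, ∑' t : ℕ, x i k t * B.q i k j * B.f i k t =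
      ∑ j with j ≠ k, ∑' t : ℕ, x i j t * B.q i j k * B.f i j t

/-- Objective of Whittle's linear program (a maximization). -/
def whittleObj (x : ∀ i, Fin (K i) → ℕ → ℝ) : ℝ :=
  ∑ i, ∑ k, ∑' t : ℕ, B.r i k * x i k t

/-! ### The balanced index policy -/

/-- Expected reward in `T` steps from playing arm `i` over and over, beginning in state `k`;
each play begins `1` step after the end of the previous one. -/
def repeatValue (i : Fin n) : ℕ → Fin (K i) → ℝ
  | 0, _ => 0
  | T + 1, k => B.r i k + ∑ j, B.trans i k 1 j * repeatValue i (T + 1 - B.L i k) j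
termination_by T _ => T
decreasing_by
  have := B.L_pos i k
  omega

/-- Playing arm `i` over and over from state `k` has average reward at least `λ + h_i`
per step. -/
def Lucrative (D : DualSolution K) (i : Fin n) (k : Fin (K i)) : Prop :=
  D.lam + D.h i ≤ liminf (fun T : ℕ => B.repeatValue i T k / (T : ℝ)) atTop

open Classical in
/-- The arms that are lucrative from a suitable start state. -/
def U₁ (D : DualSolution K) : Finset (Fin n) :=
  Finset.univ.filter fun i => ∃ k, B.Lucrative D i k

open Classical in
/-- The remaining arms with `h_i > 0`. -/
def U₂ (D : DualSolution K) : Finset (Fin n) :=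
  Finset.univ.filter fun i => i ∉ B.U₁ D ∧ 0 < D.h i

/-- The constraint of the balanced program for `i`, `k`, `t` holds with equality. -/
def Tight (D : DualSolution K) (i : Fin n) (k : Fin (K i)) (t : ℕ) : Prop :=
  (B.L i k : ℝ) * (D.lam + D.h i) + ((t : ℝ) - 1) * D.h i =
    B.r i k + B.f i k t * B.deltaP D i k

/-- State `k` of arm `i` is good (an exploitation state). -/
def Good (D : DualSolution K) (i : Fin n) (k : Fin (K i)) : Prop := B.deltaP D i k < 0

/-- Arm `i`, in the state `k` that is not good and with the last play `t` steps ago, is ready: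
`t` is at least the smallest breakpoint `t^i_k` whose constraint is tight. -/
def Ready (D : DualSolution K) (i : Fin n) (k : Fin (K i)) (t : ℕ) : Prop :=
  0 ≤ B.deltaP D i k ∧ ∃ t₀, IsLeast {u | u ∈ B.W i k ∧ B.Tight D i k u} t₀ ∧ t₀ ≤ t

/-- The arm is in `U₂`, is idle, and is in a good state. -/
def AvailGood (D : DualSolution K) (c : BanditConfig K) (i : Fin n) : Prop :=
  i ∈ B.U₂ D ∧ (c i).rem = 0 ∧ B.Good D i (c i).state

/-- The arm is in `U₂`, is idle, and is ready. -/
def AvailReady (D : DualSolution K) (c : BanditConfig K) (i : Fin n) : Prop :=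
  i ∈ B.U₂ D ∧ (c i).rem = 0 ∧ B.Ready D i (c i).state (c i).elapsed

/-- The rules for the set `a` of arms on which plays are begun in situation `c`, when `A` is the
selected set of `min(M, |U₁|)` arms of `U₁`. -/
structure BalancedIndexAction (D : DualSolution K) (A : Finset (Fin n))
    (c : BanditConfig K) (a : Finset (Fin n)) : Prop where
  /-- the arms in `A` are played continuously -/
  continuous : ∀ i ∈ A, (c i).rem = 0 → i ∈ a
  /-- other arms are played only if `|U₁| < M` and the arm is good or ready -/
  only : ∀ i ∈ a, i ∈ A ∨ ((B.U₁ D).card < B.M ∧ (B.AvailGood D c i ∨ B.AvailReady D c i))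
  /-- exploit: a ready arm is played only if no good arm is left over -/
  exploit : (∃ i ∈ a, B.AvailReady D c i) → ∀ j, B.AvailGood D c j → j ∈ a
  /-- idle: a player remains idle only if no good or ready arm is left over -/
  idle : (B.U₁ D).card < B.M → a.card < B.M - (busy c).card →
    ∀ j, B.AvailGood D c j ∨ B.AvailReady D c j → j ∈ a

open Classical in
/-- `π`, begun in the states `s`, is a balanced index policy for the solution `D` of the balanced
program; ties are broken arbitrarily. -/
def IsBalancedIndex (D : DualSolution K) (s : ∀ i, Fin (K i)) (π : B.Policy) : Prop :=
  ∃ A : Finset (Fin n), A ⊆ B.U₁ D ∧ A.card = min B.M (B.U₁ D).card ∧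
    (∀ i ∈ A, B.Lucrative D i (s i)) ∧
    ((B.U₁ D).card < B.M →
      ((B.U₂ D).filter fun i => B.Good D i (s i)).card ≤ B.M - (B.U₁ D).card) ∧
    ∀ H c a, π.Reachable s H c → π.law H c a ≠ 0 → B.BalancedIndexAction D A c a

end MonotoneBandit

end

/-! By the balance equation every feasible `D` has objective `2 M λ`, so it suffices to bound the
rate of every policy by the objective and the rate of a balanced index policy from below by `M λ`.

Upper bound. Give each idle arm the potential `p` of its state plus `h i` for each idle step, and
each arm in play its expected final `p` less `λ + h i` for each step still to come. The constraints,
extended from the breakpoints to all `t` (`BalanceFeasible.main_of_one_le`), say that reward plus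
expected rise of potential per step is at most `h i`, plus `λ` if the arm is occupied. At most `M`
arms are occupied, so the rate is at most `M λ + ∑ h` (`BalanceFeasible.exists_value_le`). The same
pairing bounds Whittle's program (`BalanceFeasible.whittleObj_le`).

Lower bound. Optimality is used through `BalanceOptimal.exists_tight`: each state of an arm of `U₂`
has a tight constraint, since otherwise the potentials of the arm could be changed so that all its
constraints become strict, and then `λ` could be lowered. In a good state the tight breakpoint is
`1`. With the idle credit capped at the ready time, an arm of `U₂` that is played by the rules gains
at least `λ + h i` per step, and one that waits to become ready gains `h i`. Arms in good states
never outnumber the players left for them, so they are played without pause. Hence in each step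
either a ready arm is left over, all players are occupied, and the arms of `U₂` together gain `(M -
|U₁|) λ`; or no ready arm is left over, and they gain `∑ h` over `U₂` (`BalanceOptimal.drift_sum`).
Together with `λ + h i` from each continuously played arm of `U₁`, both cases give `M λ`; if `|U₁| ≥
M`, the continuously played arms suffice. -/

noncomputable section

/-! ### Existence of an optimal solution of the balanced program -/

/-- A linear function that is bounded below on a nonempty polyhedron attains its minimum. -/
theorem exists_isMinOn_polyhedron {E ι : Type*} [AddCommGroup E] [Module ℝ E] [Fintype ι]
    (a : ι → Module.Dual ℝ E) (b : ι → ℝ) (c : Module.Dual ℝ E) (m : ℝ)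
    (hne : ∃ x, ∀ i, b i ≤ a i x) (hbd : ∀ x, (∀ i, b i ≤ a i x) → m ≤ c x) :
    ∃ x, (∀ i, b i ≤ a i x) ∧ ∀ y, (∀ i, b i ≤ a i y) → c x ≤ c y := by
  classical
  let act : E → Finset ι := fun x => Finset.univ.filter fun i => a i x = b i
  -- Such points replace vertices: `c` is constant on the affine space cut out by the active
  -- constraints. No finite dimension or compactness is needed.
  let Term : E → Prop := fun x =>
    (∀ i, b i ≤ a i x) ∧ ∀ d, (∀ i ∈ act x, a i d = 0) → c d = 0
  have mem_act : ∀ x i, i ∈ act x ↔ a i x = b i := by intro x i; simp [act]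
  have improve : ∀ N : ℕ, ∀ x, (∀ i, b i ≤ a i x) → Fintype.card ι - (act x).card = N →
      ∃ y, Term y ∧ c y ≤ c x := by
    intro N
    induction N using Nat.strong_induction_on with
    | _ N ih =>
      intro x hx hN
      by_cases hT : Term x
      · exact ⟨x, hT, le_rfl⟩
      have : ∃ d, (∀ i ∈ act x, a i d = 0) ∧ c d < 0 := by
        have h1 : ∃ d, (∀ i ∈ act x, a i d = 0) ∧ c d ≠ 0 := by
          by_contra! h
          exact hT ⟨hx, h⟩
        obtain ⟨d, hd, hc⟩ := h1
        rcases lt_or_gt_of_ne hc with h | h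
        · exact ⟨d, hd, h⟩
        · exact ⟨-d, fun i hi => by simp [hd i hi], by simpa using h⟩
      obtain ⟨d, hd, hc⟩ := this
      let J : Finset ι := Finset.univ.filter fun i => a i d < 0
      have mem_J : ∀ i, i ∈ J ↔ a i d < 0 := by intro i; simp [J]
      have hJ : J.Nonempty := by
        by_contra hJ
        rw [Finset.not_nonempty_iff_eq_empty] at hJ
        have hpos : ∀ i, 0 ≤ a i d := fun i => by
          by_contra h
          have := (mem_J i).2 (not_le.1 h)
          simp [hJ] at this
        -- No constraint decreases along `d`, so the whole ray is feasible; this step length brings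
        -- `c` down to `m - 1`.
        have hs : 0 ≤ (c x - m + 1) / (-c d) :=
          div_nonneg (by linarith [hbd x hx]) (by linarith)
        have := hbd (x + ((c x - m + 1) / (-c d)) • d) fun i => by
          simp only [map_add, map_smul, smul_eq_mul]
          nlinarith [hx i, mul_nonneg hs (hpos i)]
        simp only [map_add, map_smul, smul_eq_mul] at this
        have h2 : (c x - m + 1) / (-c d) * c d = -(c x - m + 1) := by
          have : c d ≠ 0 := hc.ne
          field_simp
        linarith
      -- Ratio test: stop at the first constraint met along `d`. It becomes active, and the old
      -- active constraints stay so.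
      obtain ⟨i₀, hi₀, hmin⟩ := J.exists_min_image (fun i => (a i x - b i) / (-a i d)) hJ
      rw [mem_J] at hi₀
      set s := (a i₀ x - b i₀) / (-a i₀ d) with hs
      have hs0 : 0 ≤ s := div_nonneg (by linarith [hx i₀]) (by linarith)
      have hfeas : ∀ i, b i ≤ a i (x + s • d) := by
        intro i
        simp only [map_add, map_smul, smul_eq_mul]
        rcases lt_or_ge (a i d) 0 with h | h
        · have := hmin i ((mem_J i).2 h)
          rw [le_div_iff₀ (by linarith)] at this
          linarith
        · nlinarith [hx i, mul_nonneg hs0 h]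
      have hact : act x ⊂ act (x + s • d) := by
        refine (Finset.ssubset_iff_of_subset fun i hi => ?_).2 ⟨i₀, ?_, ?_⟩
        · have h0 := hd i hi
          rw [mem_act] at hi ⊢
          simp [h0, hi]
        · rw [mem_act]
          simp only [map_add, map_smul, smul_eq_mul]
          have : a i₀ d ≠ 0 := hi₀.ne
          rw [hs]; field_simp; ring
        · intro h
          exact hi₀.ne (hd i₀ h)
      have hcard := Finset.card_lt_card hact
      have hle := Finset.card_le_univ (act (x + s • d))
      obtain ⟨y, hy, hyc⟩ := ih _ (by omega) (x + s • d) hfeas rfl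
      refine ⟨y, hy, hyc.trans ?_⟩
      simp only [map_add, map_smul, smul_eq_mul]
      nlinarith
  have determined : ∀ x y, Term x → Term y → act x = act y → c x = c y := by
    intro x y hx hy h
    have := hx.2 (x - y) fun i hi => by
      have h1 := (mem_act x i).1 hi
      have h2 := (mem_act y i).1 (h ▸ hi)
      simp [h1, h2]
    simpa [sub_eq_zero] using this
  have hfin : (c '' {x | Term x}).Finite := by
    -- A value is coded by the family of active sets at which it is attained; by `determined` the
    -- code is injective, and there are finitely many codes.
    refine Set.Finite.of_finite_image (f := fun v => {s : Finset ι | ∃ x, Term x ∧ act x = s ∧ c x = v})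
      (Set.toFinite _) ?_
    rintro _ ⟨x, hx, rfl⟩ _ ⟨y, hy, rfl⟩ h
    have : act x ∈ {s : Finset ι | ∃ z, Term z ∧ act z = s ∧ c z = c y} := by
      have h' : {s : Finset ι | ∃ z, Term z ∧ act z = s ∧ c z = c x} =
        {s : Finset ι | ∃ z, Term z ∧ act z = s ∧ c z = c y} := h
      rw [← h']
      exact ⟨x, hx, rfl, rfl⟩
    obtain ⟨z, hz, hzx, hzy⟩ := this
    rw [← hzy]
    exact determined x z hx hz hzx.symm
  obtain ⟨x₀, hx₀⟩ := hne
  obtain ⟨y₀, hy₀, -⟩ := improve _ x₀ hx₀ rfl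
  obtain ⟨_, ⟨x, hx, rfl⟩, hmin⟩ := Set.exists_min_image _ id hfin ⟨_, y₀, hy₀, rfl⟩
  refine ⟨x, hx.1, fun y hy => ?_⟩
  obtain ⟨z, hz, hzy⟩ := improve _ y hy rfl
  exact (hmin _ ⟨z, hz, rfl⟩).trans hzy

namespace MonotoneBandit

variable {n : ℕ} {K : Fin n → ℕ} (B : MonotoneBandit n K)

/-- With `p = 0` and `λ` the sum of all rewards, `L ≥ 1` settles the constraints, and equal `h i`
restore the balance. Without arms, the balance forces `λ = 0`. -/
theorem exists_balanceFeasible : ∃ D : DualSolution K, B.BalanceFeasible D := by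
  rcases Nat.eq_zero_or_pos n with rfl | hn
  · exact ⟨⟨0, fun _ => 0, fun _ _ => 0⟩, fun i => i.elim0, by simp, le_rfl, fun _ => le_rfl⟩
  have hn' : (0 : ℝ) < n := by exact_mod_cast hn
  set R : ℝ := ∑ i, ∑ k, B.r i k with hR
  have hle : ∀ i k, B.r i k ≤ R := fun i k =>
    (Finset.single_le_sum (f := fun k => B.r i k) (fun k _ => B.r_nonneg i k)
      (Finset.mem_univ k)).trans
    (Finset.single_le_sum (f := fun i => ∑ k, B.r i k)
      (fun i _ => Finset.sum_nonneg fun k _ => B.r_nonneg i k) (Finset.mem_univ i))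
  have hR0 : 0 ≤ R := Finset.sum_nonneg fun i _ => Finset.sum_nonneg fun k _ => B.r_nonneg i k
  have hh : (0 : ℝ) ≤ B.M * R / n := by positivity
  refine ⟨⟨R, fun _ => B.M * R / n, fun _ _ => 0⟩, ?_, ?_, hR0, fun _ => hh⟩
  · intro i k t ht
    have h1 : (1 : ℝ) ≤ B.L i k := by exact_mod_cast B.L_pos i k
    have h2 : (1 : ℝ) ≤ t := by exact_mod_cast B.W_pos i k t ht
    simp only [deltaP, sub_self, mul_zero, Finset.sum_const_zero, add_zero]
    nlinarith [hle i k, mul_nonneg (sub_nonneg.2 h2) hh,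
      mul_nonneg (sub_nonneg.2 h1) (add_nonneg hR0 hh)]
  · simp only [Finset.sum_const, Finset.card_univ, Fintype.card_fin, nsmul_eq_mul]
    field_simp

theorem exists_balanceOptimal : ∃ D : DualSolution K, B.BalanceOptimal D := by
  classical
  -- The `Bool` component splits the balance equation into two inequalities; the last two components
  -- are the sign conditions.
  let ι := (Σ i : Fin n, Σ k : Fin (K i), B.W i k) ⊕ (Bool ⊕ (Unit ⊕ Fin n))
  let D : ℝ × (Fin n → ℝ) × (∀ i, Fin (K i) → ℝ) → DualSolution K := fun x => ⟨x.1, x.2.1, x.2.2⟩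
  let g : ι → ℝ × (Fin n → ℝ) × (∀ i, Fin (K i) → ℝ) → ℝ := Sum.elim
    (fun z x => (B.L z.1 z.2.1 : ℝ) * (x.1 + x.2.1 z.1) + (((z.2.2 : ℕ) : ℝ) - 1) * x.2.1 z.1
      - B.f z.1 z.2.1 z.2.2 * B.deltaP (D x) z.1 z.2.1)
    (Sum.elim (fun s x => (if s then 1 else -1) * ((B.M : ℝ) * x.1 - ∑ i, x.2.1 i))
      (Sum.elim (fun _ x => x.1) (fun i x => x.2.1 i)))
  let b : ι → ℝ := Sum.elim (fun z => B.r z.1 z.2.1) fun _ => 0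
  have hg : ∀ z, IsLinearMap ℝ (g z) := by
    rintro (z | s | u | i)
    · constructor
      · intro x y
        simp only [g, D, Sum.elim_inl, deltaP, Prod.fst_add, Prod.snd_add, Pi.add_apply]
        have : ∀ j, B.q z.1 z.2.1 j * (x.2.2 z.1 j + y.2.2 z.1 j -
            (x.2.2 z.1 z.2.1 + y.2.2 z.1 z.2.1)) =
          B.q z.1 z.2.1 j * (x.2.2 z.1 j - x.2.2 z.1 z.2.1) +
          B.q z.1 z.2.1 j * (y.2.2 z.1 j - y.2.2 z.1 z.2.1) := fun j => by ring
        simp only [this, Finset.sum_add_distrib]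
        ring
      · intro r x
        simp only [g, D, Sum.elim_inl, deltaP, Prod.smul_fst, Prod.smul_snd, Pi.smul_apply,
          smul_eq_mul]
        have : ∀ j, B.q z.1 z.2.1 j * (r * x.2.2 z.1 j - r * x.2.2 z.1 z.2.1) =
          r * (B.q z.1 z.2.1 j * (x.2.2 z.1 j - x.2.2 z.1 z.2.1)) := fun j => by ring
        simp only [this, ← Finset.mul_sum]
        ring
    · constructor
      · intro x y
        simp only [g, Sum.elim_inr, Sum.elim_inl, Prod.fst_add, Prod.snd_add, Pi.add_apply,
          Finset.sum_add_distrib]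
        ring
      · intro r x
        simp only [g, Sum.elim_inr, Sum.elim_inl, Prod.smul_fst, Prod.smul_snd, Pi.smul_apply,
          smul_eq_mul, ← Finset.mul_sum]
        ring
    · exact ⟨fun x y => rfl, fun r x => rfl⟩
    · exact ⟨fun x y => rfl, fun r x => rfl⟩
  have hobj : IsLinearMap ℝ fun x => B.balanceObj (D x) := by
    constructor
    · intro x y
      simp only [balanceObj, D, Prod.fst_add, Prod.snd_add, Pi.add_apply, Finset.sum_add_distrib]
      ring
    · intro r x
      simp only [balanceObj, D, Prod.smul_fst, Prod.smul_snd, Pi.smul_apply, smul_eq_mul,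
        ← Finset.mul_sum]
      ring
  have hiff : ∀ x, (∀ z, b z ≤ (hg z).mk' _ x) ↔ B.BalanceFeasible (D x) := by
    intro x
    simp only [IsLinearMap.mk'_apply]
    constructor
    · intro h
      refine ⟨fun i k t ht => ?_, ?_, h (.inr (.inr (.inl ()))), fun i => h (.inr (.inr (.inr i)))⟩
      · have := h (.inl ⟨i, k, t, ht⟩)
        simp only [b, g, Sum.elim_inl, D] at this ⊢
        linarith
      · have h1 := h (.inr (.inl true))
        have h2 := h (.inr (.inl false))
        simp only [b, g, Sum.elim_inl, Sum.elim_inr, D, if_true, Bool.false_eq_true, if_false]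
          at h1 h2 ⊢
        linarith
    · rintro h (⟨i, k, t, ht⟩ | s | u | i)
      · have := h.main i k t ht
        simp only [b, g, Sum.elim_inl, D] at this ⊢
        linarith
      · have := h.balance
        simp only [b, g, Sum.elim_inl, Sum.elim_inr, D] at this ⊢
        simp [this]
      · exact h.lam_nonneg
      · exact h.h_nonneg i
  obtain ⟨D₀, hD₀⟩ := B.exists_balanceFeasible
  obtain ⟨x, hx, hmin⟩ := exists_isMinOn_polyhedron (fun z => (hg z).mk' _) b (hobj.mk' _) 0
    ⟨(D₀.lam, D₀.h, D₀.p), (hiff _).2 hD₀⟩ fun x hx => by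
      have := (hiff x).1 hx
      exact add_nonneg (mul_nonneg (Nat.cast_nonneg _) this.lam_nonneg)
        (Finset.sum_nonneg fun i _ => this.h_nonneg i)
  exact ⟨D x, (hiff x).1 hx, fun D' hD' => hmin (D'.lam, D'.h, D'.p) ((hiff _).2 hD')⟩

end MonotoneBandit
end
-- One-step expectations, backward induction, and the constraints at all times
noncomputable section

namespace MonotoneBandit

variable {n : ℕ} {K : Fin n → ℕ} (B : MonotoneBandit n K)

/-! ### One arm -/

theorem f_le_f (i : Fin n) (k : Fin (K i)) {s t : ℕ} (hs : 1 ≤ s) (hst : s ≤ t) :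
    B.f i k s ≤ B.f i k t := by
  induction t, hst using Nat.le_induction with
  | base => exact le_rfl
  | succ t h ih => exact ih.trans (B.f_mono i k t (hs.trans h))

/-- Staying in `k` has the complementary probability, so only differences from `v k` survive; this
is how `deltaP` enters the drift computations. -/
theorem sum_trans_mul (i : Fin n) (k : Fin (K i)) (t : ℕ) (v : Fin (K i) → ℝ) :
    ∑ j, B.trans i k t j * v j =
      v k + B.f i k t * ∑ j with j ≠ k, B.q i k j * (v j - v k) := by
  have h1 : ∑ j, B.trans i k t j * v j = B.trans i k t k * v k +
      ∑ j with j ≠ k, B.trans i k t j * v j := by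
    rw [← Finset.sum_filter_add_sum_filter_not Finset.univ (fun j => j = k)]
    simp [Finset.filter_eq']
  have h2 : ∑ j with j ≠ k, B.trans i k t j * v j =
      ∑ j with j ≠ k, B.q i k j * B.f i k t * v j := by
    refine Finset.sum_congr rfl fun j hj => ?_
    rw [trans, if_neg (Finset.mem_filter.1 hj).2]
  rw [h1, h2, trans, if_pos rfl, Finset.mul_sum, sub_mul, one_mul, Finset.sum_mul,
    sub_add_eq_add_sub, add_sub_assoc, ← Finset.sum_sub_distrib]
  congr 1
  exact Finset.sum_congr rfl fun j _ => by ring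

theorem sum_trans_mul_p (D : DualSolution K) (i : Fin n) (k : Fin (K i)) (t : ℕ) :
    ∑ j, B.trans i k t j * D.p i j = D.p i k + B.f i k t * B.deltaP D i k :=
  B.sum_trans_mul i k t (D.p i)

theorem sum_trans (i : Fin n) (k : Fin (K i)) (t : ℕ) : ∑ j, B.trans i k t j = 1 := by
  simpa using B.sum_trans_mul i k t fun _ => 1

theorem trans_nonneg (i : Fin n) (k : Fin (K i)) {t : ℕ} (ht : 1 ≤ t) (j : Fin (K i)) :
    0 ≤ B.trans i k t j := by
  unfold trans
  split_ifs
  · rw [← Finset.sum_mul]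
    have := mul_le_one₀ (B.q_sum_le i k) (B.f_nonneg i k t ht) (B.f_le_one i k t ht)
    linarith
  · exact mul_nonneg (B.q_nonneg i k j) (B.f_nonneg i k t ht)

theorem armProb_nonneg (i : Fin n) (c : ArmStatus (K i)) (play : Prop) [Decidable play]
    (hc : 1 ≤ c.elapsed) (j : Fin (K i)) : 0 ≤ B.armProb i c play j := by
  unfold armProb
  split_ifs
  · exact B.trans_nonneg i _ hc j
  · exact zero_le_one
  · exact le_rfl

theorem sum_armProb (i : Fin n) (c : ArmStatus (K i)) (play : Prop) [Decidable play] :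
    ∑ j, B.armProb i c play j = 1 := by
  unfold armProb
  split_ifs
  · exact B.sum_trans i _ _
  · simp

/-- Expectation of `g` at the situation of arm `i` after the coming step. -/
def armExp (i : Fin n) (c : ArmStatus (K i)) (play : Prop) [Decidable play]
    (g : ArmStatus (K i) → ℝ) : ℝ :=
  ∑ j, B.armProb i c play j * g (B.armNext i c play j)

theorem armExp_of_idle {i : Fin n} {c : ArmStatus (K i)} {play : Prop} [Decidable play]
    (hr : c.rem = 0) (hp : ¬ play) (g : ArmStatus (K i) → ℝ) :
    B.armExp i c play g = g ⟨c.state, c.elapsed + 1, 0⟩ := by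
  have h0 : B.occupied i c play = 0 := by simp [occupied, hr, hp]
  simp [armExp, armNext, h0, ← Finset.sum_mul, B.sum_armProb]

theorem armExp_of_occupied {i : Fin n} {c : ArmStatus (K i)} {play : Prop} [Decidable play]
    (h : B.occupied i c play = 1) (g : ArmStatus (K i) → ℝ) :
    B.armExp i c play g = ∑ j, B.trans i c.state c.elapsed j * g ⟨j, 1, 0⟩ := by
  simp [armExp, armNext, armProb, h]

theorem armExp_of_two_le {i : Fin n} {c : ArmStatus (K i)} {play : Prop} [Decidable play]
    (h : 2 ≤ B.occupied i c play) (g : ArmStatus (K i) → ℝ) :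
    B.armExp i c play g = g ⟨c.state, c.elapsed, B.occupied i c play - 1⟩ := by
  have h0 : B.occupied i c play ≠ 0 := by omega
  have h1 : B.occupied i c play ≠ 1 := by omega
  simp [armExp, armNext, h0, h1, ← Finset.sum_mul, B.sum_armProb]

theorem occupied_of_play {i : Fin n} {c : ArmStatus (K i)} {play : Prop} [Decidable play]
    (hr : c.rem = 0) (hp : play) : B.occupied i c play = B.L i c.state := by
  simp [occupied, hr, hp]

theorem occupied_of_busy {i : Fin n} {c : ArmStatus (K i)} {play : Prop} [Decidable play]
    (hr : c.rem ≠ 0) : B.occupied i c play = c.rem := by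
  simp [occupied, hr]

/-! ### All arms -/

theorem jointProb_nonneg {c : BanditConfig K} (hc : ∀ i, 1 ≤ (c i).elapsed)
    (a : Finset (Fin n)) (s : ∀ i, Fin (K i)) : 0 ≤ B.jointProb c a s :=
  Finset.prod_nonneg fun i _ => B.armProb_nonneg i _ _ (hc i) _

/-- Independence: `g` is absorbed into factor `i`, the sum of products factorizes, and the other
factors sum to `1`. Hence sums of potentials can be treated arm by arm. -/
theorem sum_jointProb_mul (c : BanditConfig K) (a : Finset (Fin n)) (i : Fin n)
    (g : Fin (K i) → ℝ) :
    ∑ s, B.jointProb c a s * g (s i) = ∑ j, B.armProb i (c i) (i ∈ a) j * g j := by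
  have h : ∀ s : (∀ l, Fin (K l)), B.jointProb c a s * g (s i) =
      ∏ l, (B.armProb l (c l) (l ∈ a) (s l) * if h : l = i then g (h ▸ s l) else 1) := by
    intro s
    rw [Finset.prod_mul_distrib, jointProb]
    congr 1
    rw [Finset.prod_eq_single i]
    · simp
    · intro l _ hl; simp [hl]
    · simp
  simp only [h]
  rw [← Fintype.piFinset_univ, ← Finset.prod_univ_sum (fun l => Finset.univ)
    (fun l j => B.armProb l (c l) (l ∈ a) j * if h : l = i then g (h ▸ j) else 1),
    Finset.prod_eq_single i]
  · simp
  · intro l _ hl; simp [hl, B.sum_armProb]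
  · simp

theorem sum_jointProb (c : BanditConfig K) (a : Finset (Fin n)) :
    ∑ s, B.jointProb c a s = 1 := by
  unfold jointProb
  rw [← Fintype.piFinset_univ, ← Finset.prod_univ_sum (fun l => Finset.univ)
    (fun l j => B.armProb l (c l) (l ∈ a) j)]
  simp [B.sum_armProb]

theorem sum_jointProb_mul_sum (c : BanditConfig K) (a S : Finset (Fin n))
    (g : ∀ i, ArmStatus (K i) → ℝ) :
    ∑ s, B.jointProb c a s * ∑ i ∈ S, g i (B.next c a s i) =
      ∑ i ∈ S, B.armExp i (c i) (i ∈ a) (g i) := by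
  simp only [Finset.mul_sum]
  rw [Finset.sum_comm]
  exact Finset.sum_congr rfl fun i _ =>
    B.sum_jointProb_mul c a i fun j => g i (B.armNext i (c i) (i ∈ a) j)

theorem sum_jointProb_mul_add_const (c : BanditConfig K) (a : Finset (Fin n))
    (F : (∀ i, Fin (K i)) → ℝ) (C : ℝ) :
    ∑ s, B.jointProb c a s * (F s + C) = ∑ s, B.jointProb c a s * F s + C := by
  simp only [mul_add, Finset.sum_add_distrib, ← Finset.sum_mul, B.sum_jointProb, one_mul]

theorem reward_nonneg (c : BanditConfig K) (a : Finset (Fin n)) : 0 ≤ B.reward c a :=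
  Finset.sum_nonneg fun i _ => B.r_nonneg i _

theorem sum_ite_reward (c : BanditConfig K) (a S : Finset (Fin n)) (h : a ⊆ S) :
    ∑ i ∈ S, (if i ∈ a then B.r i (c i).state else 0) = B.reward c a := by
  rw [← Finset.sum_filter, Finset.filter_mem_eq_inter, Finset.inter_eq_right.2 h, reward]

/-! ### Induction along the process -/

variable {B}

theorem Policy.sum_law (π : B.Policy) (H : BanditHistory K) (c : BanditConfig K) :
    ∑ a, (π.law H c a).toReal = 1 := by
  have h := (π.law H c).tsum_coe
  rw [tsum_fintype] at h
  rw [← ENNReal.toReal_sum fun a _ => (π.law H c).apply_ne_top a, h, ENNReal.toReal_one]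

theorem Policy.Reachable.invariant {π : B.Policy} {s : ∀ i, Fin (K i)}
    {I : BanditConfig K → Prop} (h0 : I (start s))
    (hstep : ∀ H c a s', π.Reachable s H c → I c → π.law H c a ≠ 0 → I (B.next c a s'))
    {H : BanditHistory K} {c : BanditConfig K} (h : π.Reachable s H c) : I c := by
  induction h with
  | init => exact h0
  | step H c a s' hr ha _ ih => exact hstep H c a s' hr ih ha

theorem Policy.Reachable.one_le_elapsed {π : B.Policy} {s : ∀ i, Fin (K i)}
    {H : BanditHistory K} {c : BanditConfig K} (h : π.Reachable s H c) :
    ∀ i, 1 ≤ (c i).elapsed := by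
  refine h.invariant (I := fun c => ∀ i, 1 ≤ (c i).elapsed) (fun i => le_rfl) ?_
  intro H c a s' _ hc _ i
  simp only [next, armNext]
  split_ifs
  · exact Nat.le_add_left _ _
  · exact le_rfl
  · exact hc i

/-- Backward induction over the horizon. The inequality is asked only for reachable situations and
actions of positive probability, where invariants are available; all other terms have weight zero.
-/
theorem Policy.value_le_of_potential {π : B.Policy} {s : ∀ i, Fin (K i)}
    (Ψ : ℕ → BanditConfig K → ℝ)
    (h0 : ∀ H c, π.Reachable s H c → 0 ≤ Ψ 0 c)
    (hstep : ∀ T H c a, π.Reachable s H c → π.law H c a ≠ 0 →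
      B.reward c a + ∑ s', B.jointProb c a s' * Ψ T (B.next c a s') ≤ Ψ (T + 1) c)
    (T : ℕ) : ∀ H c, π.Reachable s H c → π.value T H c ≤ Ψ T c := by
  induction T with
  | zero => exact h0
  | succ T ih =>
    intro H c hc
    rw [Policy.value]
    calc _ ≤ ∑ a, (π.law H c a).toReal * Ψ (T + 1) c := by
          refine Finset.sum_le_sum fun a _ => ?_
          rcases eq_or_ne (π.law H c a) 0 with ha | ha
          · simp [ha]
          refine mul_le_mul_of_nonneg_left (le_trans ?_ (hstep T H c a hc ha))
            ENNReal.toReal_nonneg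
          refine add_le_add le_rfl (Finset.sum_le_sum fun s' _ => ?_)
          rcases (B.jointProb_nonneg hc.one_le_elapsed a s').eq_or_lt with hs | hs
          · simp [← hs]
          · exact mul_le_mul_of_nonneg_left (ih _ _ (.step H c a s' hc ha hs)) hs.le
      _ = Ψ (T + 1) c := by rw [← Finset.sum_mul, π.sum_law, one_mul]

theorem Policy.le_value_of_potential {π : B.Policy} {s : ∀ i, Fin (K i)}
    (Ψ : ℕ → BanditConfig K → ℝ)
    (h0 : ∀ H c, π.Reachable s H c → Ψ 0 c ≤ 0)
    (hstep : ∀ T H c a, π.Reachable s H c → π.law H c a ≠ 0 →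
      Ψ (T + 1) c ≤ B.reward c a + ∑ s', B.jointProb c a s' * Ψ T (B.next c a s'))
    (T : ℕ) : ∀ H c, π.Reachable s H c → Ψ T c ≤ π.value T H c := by
  induction T with
  | zero => exact h0
  | succ T ih =>
    intro H c hc
    rw [Policy.value]
    calc Ψ (T + 1) c = ∑ a, (π.law H c a).toReal * Ψ (T + 1) c := by
          rw [← Finset.sum_mul, π.sum_law, one_mul]
      _ ≤ _ := by
          refine Finset.sum_le_sum fun a _ => ?_
          rcases eq_or_ne (π.law H c a) 0 with ha | ha
          · simp [ha]
          refine mul_le_mul_of_nonneg_left (le_trans (hstep T H c a hc ha) ?_)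
            ENNReal.toReal_nonneg
          refine add_le_add le_rfl (Finset.sum_le_sum fun s' _ => ?_)
          rcases (B.jointProb_nonneg hc.one_le_elapsed a s').eq_or_lt with hs | hs
          · simp [← hs]
          · exact mul_le_mul_of_nonneg_left (ih _ _ (.step H c a s' hc ha hs)) hs.le

theorem Policy.value_nonneg {π : B.Policy} {s : ∀ i, Fin (K i)} (T : ℕ) :
    0 ≤ π.value T [] (start s) :=
  π.le_value_of_potential (s := s) (fun _ _ => 0) (fun _ _ _ => le_rfl)
    (fun _ _ c a _ _ => by simpa using B.reward_nonneg c a) T _ _ .init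

variable (B)

/-! ### The dual constraints for all times -/

-- Between two breakpoints both sides are affine in `t`, so the constraint is a convex combination
-- of those at the ends. From the last breakpoint on, the left side is constant and the right side
-- does not decrease, because `h i ≥ 0`.
variable {B} in
theorem BalanceFeasible.main_of_one_le {D : DualSolution K} (hD : B.BalanceFeasible D)
    (i : Fin n) (k : Fin (K i)) {t : ℕ} (ht : 1 ≤ t) :
    B.r i k + B.f i k t * B.deltaP D i k ≤
      (B.L i k : ℝ) * (D.lam + D.h i) + ((t : ℝ) - 1) * D.h i := by
  obtain ⟨t₁, h₁, hmax⟩ := ((B.W i k).filter (· ≤ t)).exists_max_image id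
    ⟨1, Finset.mem_filter.2 ⟨B.one_mem_W i k, ht⟩⟩
  obtain ⟨h₁W, h₁t⟩ := Finset.mem_filter.1 h₁
  have hm₁ := hD.main i k t₁ h₁W
  by_cases hex : ((B.W i k).filter (t < ·)).Nonempty
  · obtain ⟨t₂, h₂, hmin⟩ := ((B.W i k).filter (t < ·)).exists_min_image id hex
    obtain ⟨h₂W, h₂t⟩ := Finset.mem_filter.1 h₂
    have hm₂ := hD.main i k t₂ h₂W
    have hf := B.f_interp i k t₁ h₁W t₂ h₂W (h₁t.trans_lt h₂t) (fun s hs h => by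
      rcases le_or_gt s t with hst | hst
      · exact absurd (hmax s (Finset.mem_filter.2 ⟨hs, hst⟩)) (not_le.2 h.1)
      · exact absurd (hmin s (Finset.mem_filter.2 ⟨hs, hst⟩)) (not_le.2 h.2)) t h₁t h₂t.le
    have hlt : (0 : ℝ) < (t₂ : ℝ) - t₁ := by
      rw [sub_pos]; exact_mod_cast h₁t.trans_lt h₂t
    have e₁ : (0 : ℝ) ≤ (t : ℝ) - t₁ := by rw [sub_nonneg]; exact_mod_cast h₁t
    have e₂ : (0 : ℝ) ≤ (t₂ : ℝ) - t := by rw [sub_nonneg]; exact_mod_cast h₂t.le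
    have hf' : B.f i k t * ((t₂ : ℝ) - t₁) =
        ((t₂ : ℝ) - t) * B.f i k t₁ + ((t : ℝ) - t₁) * B.f i k t₂ := by
      rw [hf]; field_simp
    have a₁ := mul_le_mul_of_nonneg_left hm₁ e₂
    have a₂ := mul_le_mul_of_nonneg_left hm₂ e₁
    refine le_of_mul_le_mul_right ?_ hlt
    have : (B.r i k + B.f i k t * B.deltaP D i k) * ((t₂ : ℝ) - t₁) =
        ((t₂ : ℝ) - t) * (B.r i k + B.f i k t₁ * B.deltaP D i k) +
        ((t : ℝ) - t₁) * (B.r i k + B.f i k t₂ * B.deltaP D i k) := by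
      linear_combination B.deltaP D i k * hf'
    rw [this]
    refine (add_le_add a₁ a₂).trans (le_of_eq ?_)
    ring
  · rw [Finset.not_nonempty_iff_eq_empty, Finset.filter_eq_empty_iff] at hex
    rw [B.f_tail i k t₁ h₁W (fun s hs =>
      hmax s (Finset.mem_filter.2 ⟨hs, not_lt.1 (hex hs)⟩)) t h₁t]
    have : ((t₁ : ℝ) - 1) * D.h i ≤ ((t : ℝ) - 1) * D.h i := by
      have : (t₁ : ℝ) ≤ t := by exact_mod_cast h₁t
      exact mul_le_mul_of_nonneg_right (by linarith) (hD.h_nonneg i)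
    linarith

end MonotoneBandit
end
-- Potentials of arms, the bound for all policies, and weak duality
noncomputable section

namespace MonotoneBandit

variable {n : ℕ} {K : Fin n → ℕ} (B : MonotoneBandit n K)

/-! ### Occupied arms -/

theorem occupied_ne_zero_iff {c : BanditConfig K} {a : Finset (Fin n)} {i : Fin n} :
    B.occupied i (c i) (i ∈ a) ≠ 0 ↔ i ∈ a ∪ busy c := by
  have := B.L_pos i (c i).state
  by_cases hr : (c i).rem = 0 <;> by_cases ha : i ∈ a <;> simp [occupied, busy, hr, ha]
  omega

theorem busy_next_subset (c : BanditConfig K) (a : Finset (Fin n)) (s : ∀ i, Fin (K i)) :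
    busy (B.next c a s) ⊆ a ∪ busy c := by
  intro i hi
  rw [← B.occupied_ne_zero_iff]
  intro h0
  refine (Finset.mem_filter.1 hi).2 ?_
  simp only [next, armNext]
  rw [if_pos h0]

theorem card_union_busy_le {c : BanditConfig K} {a : Finset (Fin n)} (h : B.Legal c a)
    (hb : (busy c).card ≤ B.M) : (a ∪ busy c).card ≤ B.M := by
  have := Finset.card_union_le a (busy c)
  have := h.2
  omega

variable {B}

theorem Policy.Reachable.card_busy_le {π : B.Policy} {s : ∀ i, Fin (K i)}
    {H : BanditHistory K} {c : BanditConfig K} (h : π.Reachable s H c) :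
    (busy c).card ≤ B.M := by
  refine h.invariant (I := fun c => (busy c).card ≤ B.M) (by simp [busy, start]) ?_
  intro H c a s' _ hc ha
  exact (Finset.card_le_card (B.busy_next_subset c a s')).trans
    (B.card_union_busy_le (π.legal H c a ha) hc)

theorem Policy.Reachable.rem_le {π : B.Policy} {s : ∀ i, Fin (K i)}
    {H : BanditHistory K} {c : BanditConfig K} (h : π.Reachable s H c) :
    ∀ i, (c i).rem ≤ B.L i (c i).state := by
  refine h.invariant (I := fun c => ∀ i, (c i).rem ≤ B.L i (c i).state)
    (fun i => Nat.zero_le _) ?_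
  intro H c a s' _ hc _ i
  simp only [next, armNext]
  split_ifs
  · exact Nat.zero_le _
  · exact Nat.zero_le _
  · have := hc i
    simp only [occupied]
    split_ifs <;> omega

variable (B)

/-! ### Potentials -/

/-- The potential of an arm for the dual solution `D`, where an idle arm in state `k` has
the credit `u k t` for an idle period of length `t`. -/
def potential (D : DualSolution K) (i : Fin n) (u : Fin (K i) → ℕ → ℝ) (c : ArmStatus (K i)) : ℝ :=
  if c.rem = 0 then D.p i c.state + u c.state c.elapsed
  else D.p i c.state + B.f i c.state c.elapsed * B.deltaP D i c.state -
    c.rem * (D.lam + D.h i)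

/-- One formula for beginning, continuing and ending a play. The condition `hu` covers the end,
where the arm becomes idle with `elapsed = 1`. -/
theorem armExp_potential (D : DualSolution K) {i : Fin n} {u : Fin (K i) → ℕ → ℝ}
    (hu : ∀ k, u k 1 = 0) {c : ArmStatus (K i)} {play : Prop} [Decidable play]
    (h : B.occupied i c play ≠ 0) :
    B.armExp i c play (B.potential D i u) =
      D.p i c.state + B.f i c.state c.elapsed * B.deltaP D i c.state -
        ((B.occupied i c play : ℝ) - 1) * (D.lam + D.h i) := by
  rcases eq_or_ne (B.occupied i c play) 1 with h1 | h1
  · rw [B.armExp_of_occupied h1, h1]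
    simp [potential, hu, B.sum_trans_mul_p]
  · have h2 : 2 ≤ B.occupied i c play := by omega
    rw [B.armExp_of_two_le h2, potential, if_neg (show B.occupied i c play - 1 ≠ 0 by omega)]
    simp only
    rw [Nat.cast_sub (by omega), Nat.cast_one]

theorem armExp_potential_of_play (D : DualSolution K) {i : Fin n} {u : Fin (K i) → ℕ → ℝ}
    (hu : ∀ k, u k 1 = 0) {c : ArmStatus (K i)} {play : Prop} [Decidable play]
    (hr : c.rem = 0) (hp : play) :
    B.armExp i c play (B.potential D i u) = B.potential D i u c +
      (B.f i c.state c.elapsed * B.deltaP D i c.state -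
        (B.L i c.state : ℝ) * (D.lam + D.h i) - u c.state c.elapsed) + (D.lam + D.h i) := by
  have ho := B.occupied_of_play hr hp
  have := B.L_pos i c.state
  rw [B.armExp_potential D hu (by omega), ho, potential, if_pos hr]
  ring

theorem armExp_potential_of_busy (D : DualSolution K) {i : Fin n} {u : Fin (K i) → ℕ → ℝ}
    (hu : ∀ k, u k 1 = 0) {c : ArmStatus (K i)} {play : Prop} [Decidable play]
    (hr : c.rem ≠ 0) :
    B.armExp i c play (B.potential D i u) = B.potential D i u c + (D.lam + D.h i) := by
  have ho := B.occupied_of_busy (play := play) hr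
  rw [B.armExp_potential D hu (by omega), ho, potential, if_neg hr]
  ring

theorem armExp_potential_of_idle (D : DualSolution K) {i : Fin n} {u : Fin (K i) → ℕ → ℝ}
    {c : ArmStatus (K i)} {play : Prop} [Decidable play] (hr : c.rem = 0) (hp : ¬ play) :
    B.armExp i c play (B.potential D i u) = B.potential D i u c +
      (u c.state (c.elapsed + 1) - u c.state c.elapsed) := by
  rw [B.armExp_of_idle hr hp, potential, potential, if_pos hr, if_pos rfl]
  ring

theorem abs_f_mul_le (D : DualSolution K) (i : Fin n) (k : Fin (K i)) {t : ℕ} (ht : 1 ≤ t) :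
    |B.f i k t * B.deltaP D i k| ≤ |B.deltaP D i k| := by
  rw [abs_mul, abs_of_nonneg (B.f_nonneg i k t ht)]
  exact mul_le_of_le_one_left (abs_nonneg _) (B.f_le_one i k t ht)

/-! ### The upper bound -/

variable {B}

/-- Dual solutions bound the expected reward of every policy, up to a constant. -/
theorem BalanceFeasible.exists_value_le {D : DualSolution K} (hD : B.BalanceFeasible D)
    (π : B.Policy) (s : ∀ i, Fin (K i)) :
    ∃ C, ∀ T, π.value T [] (start s) ≤ T * B.balanceObj D + C := by
  -- The credit is not capped here. The potential may be unbounded above, but only a lower bound is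
  -- needed, and `C` compensates it at horizon `0`.
  let u : ∀ i, Fin (K i) → ℕ → ℝ := fun i _ t => ((t : ℝ) - 1) * D.h i
  have hu : ∀ i k, u i k 1 = 0 := by simp [u]
  let b : ∀ i, Fin (K i) → ℝ := fun i k =>
    |D.p i k| + |B.deltaP D i k| + B.L i k * (D.lam + D.h i)
  have hlh : ∀ i, 0 ≤ D.lam + D.h i := fun i => add_nonneg hD.lam_nonneg (hD.h_nonneg i)
  have hb : ∀ i k, 0 ≤ b i k := fun i k => by have := hlh i; positivity
  let C := ∑ i, ∑ k, b i k
  let Ψ : ℕ → BanditConfig K → ℝ := fun T c =>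
    T * B.balanceObj D + C + ∑ i, B.potential D i (u i) (c i)
  refine ⟨C + ∑ i, B.potential D i (u i) (start s i), fun T => ?_⟩
  rw [← add_assoc]
  refine π.value_le_of_potential (s := s) Ψ ?_ ?_ T _ _ .init
  · intro H c hc
    have : ∀ i, -∑ k, b i k ≤ B.potential D i (u i) (c i) := by
      intro i
      have h1 : b i (c i).state ≤ ∑ k, b i k :=
        Finset.single_le_sum (fun k _ => hb i k) (Finset.mem_univ _)
      have h2 := hc.one_le_elapsed i
      have h3 : ((c i).rem : ℝ) ≤ B.L i (c i).state := by exact_mod_cast hc.rem_le i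
      have h4 := neg_abs_le (D.p i (c i).state)
      have h5 := abs_nonneg (B.deltaP D i (c i).state)
      have h6 := (abs_le.1 (B.abs_f_mul_le D i (c i).state h2)).1
      have h7 := mul_le_mul_of_nonneg_right h3 (hlh i)
      have h8 : 0 ≤ (B.L i (c i).state : ℝ) * (D.lam + D.h i) :=
        mul_nonneg (Nat.cast_nonneg _) (hlh i)
      have h9 : (0 : ℝ) ≤ (((c i).elapsed : ℝ) - 1) * D.h i :=
        mul_nonneg (sub_nonneg.2 (by exact_mod_cast h2)) (hD.h_nonneg i)
      simp only [b] at h1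
      simp only [potential, u]
      split_ifs <;> linarith
    have := Finset.sum_le_sum fun i (_ : i ∈ Finset.univ) => this i
    simp only [Finset.sum_neg_distrib] at this
    simp only [Ψ, C, Nat.cast_zero]
    linarith
  · intro T H c a hc ha
    have hleg := π.legal H c a ha
    have hle := hc.one_le_elapsed
    -- When a play begins, this is the dual constraint for `t = elapsed`; in the other cases
    -- equality holds.
    have harm : ∀ i, (if i ∈ a then B.r i (c i).state else 0) +
        B.armExp i (c i) (i ∈ a) (B.potential D i (u i)) ≤
        B.potential D i (u i) (c i) + D.h i + if i ∈ a ∪ busy c then D.lam else 0 := by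
      intro i
      rcases eq_or_ne (c i).rem 0 with hr | hr
      · by_cases hi : i ∈ a
        · rw [B.armExp_potential_of_play D (hu i) hr hi, if_pos hi,
            if_pos (Finset.mem_union_left _ hi)]
          have := hD.main_of_one_le i (c i).state (hle i)
          simp only [u]
          linarith
        · rw [B.armExp_potential_of_idle D hr hi, if_neg hi,
            if_neg (by simp [busy, hi, hr])]
          simp only [u]
          push_cast
          linarith
      · have hi : i ∉ a := fun h => hr (hleg.1 i h)
        rw [B.armExp_potential_of_busy D (hu i) hr, if_neg hi, if_pos (by simp [busy, hr])]
        linarith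
    have hsum := Finset.sum_le_sum fun i (_ : i ∈ Finset.univ) => harm i
    simp only [Finset.sum_add_distrib] at hsum
    rw [B.sum_ite_reward c a _ (Finset.subset_univ a), ← Finset.sum_filter,
      Finset.sum_const, nsmul_eq_mul] at hsum
    have hcard : ((Finset.univ.filter fun i => i ∈ a ∪ busy c).card : ℝ) * D.lam ≤ B.M * D.lam := by
      refine mul_le_mul_of_nonneg_right ?_ hD.lam_nonneg
      rw [Finset.filter_univ_mem]
      exact_mod_cast B.card_union_busy_le hleg hc.card_busy_le
    have hE : ∑ s', B.jointProb c a s' * Ψ T (B.next c a s') =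
        ∑ i, B.armExp i (c i) (i ∈ a) (B.potential D i (u i)) + (T * B.balanceObj D + C) := by
      rw [← B.sum_jointProb_mul_sum c a Finset.univ fun i => B.potential D i (u i),
        ← B.sum_jointProb_mul_add_const]
      exact Finset.sum_congr rfl fun s' _ => by simp only [Ψ]; ring
    rw [hE]
    simp only [Ψ]
    push_cast
    have : B.balanceObj D = B.M * D.lam + ∑ i, D.h i := rfl
    linarith

/-- Weak duality. -/
theorem BalanceFeasible.whittleObj_le {D : DualSolution K} (hD : B.BalanceFeasible D)
    {x : ∀ i, Fin (K i) → ℕ → ℝ} (hx : B.WhittleFeasible x) :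
    B.whittleObj x ≤ B.balanceObj D := by
  have hxs : ∀ i k, Summable (x i k) := fun i k =>
    (hx.summable i k).of_nonneg_of_le (hx.nonneg i k) fun t => by
      rcases Nat.eq_zero_or_pos t with rfl | ht
      · simp [hx.zero]
      · have : (1 : ℝ) ≤ t := by exact_mod_cast ht
        exact le_mul_of_one_le_left (hx.nonneg i k t) this
  have hfs : ∀ i k, Summable fun t => x i k t * B.f i k t := fun i k => by
    refine (hxs i k).of_norm_bounded fun t => ?_
    rcases Nat.eq_zero_or_pos t with rfl | ht
    · simp [hx.zero]
    · rw [norm_mul, Real.norm_of_nonneg (hx.nonneg i k t), Real.norm_of_nonneg (B.f_nonneg i k t ht)]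
      exact mul_le_of_le_one_right (hx.nonneg i k t) (B.f_le_one i k t ht)
  have hLs : ∀ i k, Summable fun t : ℕ => ((t : ℝ) + B.L i k - 1) * x i k t := fun i k => by
    refine ((hx.summable i k).add ((hxs i k).mul_left ((B.L i k : ℝ) - 1))).congr fun t => ?_
    ring
  let F : ∀ i, Fin (K i) → ℝ := fun i k => ∑' t, x i k t * B.f i k t
  have hmain : ∀ i k, ∑' t : ℕ, B.r i k * x i k t ≤
      D.lam * (∑' t : ℕ, (B.L i k : ℝ) * x i k t) +
      D.h i * (∑' t : ℕ, ((t : ℝ) + B.L i k - 1) * x i k t) - B.deltaP D i k * F i k := by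
    intro i k
    rw [← tsum_mul_left, ← tsum_mul_left, ← tsum_mul_left,
      ← (((hxs i k).mul_left _).mul_left _).tsum_add ((hLs i k).mul_left _),
      ← Summable.tsum_sub ((((hxs i k).mul_left _).mul_left _).add ((hLs i k).mul_left _))
        ((hfs i k).mul_left _)]
    refine Summable.tsum_le_tsum (fun t => ?_) ((hxs i k).mul_left _)
      (((((hxs i k).mul_left _).mul_left _).add ((hLs i k).mul_left _)).sub
        ((hfs i k).mul_left _))
    rcases Nat.eq_zero_or_pos t with rfl | ht
    · simp [hx.zero]
    · have := mul_le_mul_of_nonneg_right (hD.main_of_one_le i k ht) (hx.nonneg i k t)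
      linarith
  -- Summation by parts: conservation of flow cancels the potentials.
  have hflow : ∀ i, ∑ k, B.deltaP D i k * F i k = 0 := by
    intro i
    have h1 : ∀ k, (∑ j with j ≠ k, B.q i k j) * F i k = ∑ j with j ≠ k, B.q i j k * F i j := by
      intro k
      have := hx.flow i k
      rw [Finset.sum_mul]
      refine Eq.trans (Finset.sum_congr rfl fun j _ => ?_)
        (this.trans (Finset.sum_congr rfl fun j _ => ?_))
      · rw [← tsum_mul_left]; exact tsum_congr fun t => by ring
      · rw [← tsum_mul_left]; exact tsum_congr fun t => by ring
    have h2 : ∀ k, B.deltaP D i k * F i k = ∑ j with j ≠ k, D.p i j * (B.q i k j * F i k) -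
        D.p i k * ∑ j with j ≠ k, B.q i j k * F i j := by
      intro k
      rw [← h1, deltaP, Finset.sum_mul, Finset.sum_mul, Finset.mul_sum, ← Finset.sum_sub_distrib]
      exact Finset.sum_congr rfl fun j _ => by ring
    simp only [h2, Finset.sum_sub_distrib, Finset.mul_sum, Finset.sum_filter]
    rw [Finset.sum_comm, sub_eq_zero]
    exact Finset.sum_congr rfl fun j _ => Finset.sum_congr rfl fun k _ => by
      simp [ne_comm]
  have hplayers := mul_le_mul_of_nonneg_left hx.players hD.lam_nonneg
  have hidle := Finset.sum_le_sum fun i (_ : i ∈ Finset.univ) =>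
    mul_le_mul_of_nonneg_left (hx.idle i) (hD.h_nonneg i)
  have hsum : B.whittleObj x ≤ _ :=
    Finset.sum_le_sum fun i (_ : i ∈ Finset.univ) =>
      Finset.sum_le_sum fun k (_ : k ∈ Finset.univ) => hmain i k
  simp only [Finset.sum_sub_distrib, Finset.sum_add_distrib, ← Finset.mul_sum, hflow,
    sub_zero] at hsum
  simp only [mul_one] at hidle
  unfold balanceObj
  linarith

end MonotoneBandit
end
-- Repeated plays of one arm, and tight constraints at an optimum
noncomputable section

namespace MonotoneBandit

variable {n : ℕ} {K : Fin n → ℕ} (B : MonotoneBandit n K)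

/-! ### Playing one arm over and over -/

theorem repeatValue_nonneg (i : Fin n) (T : ℕ) (k : Fin (K i)) : 0 ≤ B.repeatValue i T k := by
  induction T using Nat.strong_induction_on generalizing k with
  | _ T ih =>
    cases T with
    | zero => simp [repeatValue]
    | succ T =>
      rw [repeatValue]
      have := B.L_pos i k
      exact add_nonneg (B.r_nonneg i k) (Finset.sum_nonneg fun j _ =>
        mul_nonneg (B.trans_nonneg i k le_rfl j) (ih _ (by omega) j))

/-- A crude bound; it provides the boundedness without which a `liminf` in `ℝ` is not meaningful. -/
theorem repeatValue_le (i : Fin n) (T : ℕ) (k : Fin (K i)) :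
    B.repeatValue i T k ≤ T * ∑ j, B.r i j := by
  induction T using Nat.strong_induction_on generalizing k with
  | _ T ih =>
    cases T with
    | zero => simp [repeatValue]
    | succ T =>
      rw [repeatValue]
      have hL := B.L_pos i k
      have hR : 0 ≤ ∑ j, B.r i j := Finset.sum_nonneg fun j _ => B.r_nonneg i j
      have h1 : ∑ j, B.trans i k 1 j * B.repeatValue i (T + 1 - B.L i k) j ≤
          ∑ j, B.trans i k 1 j * (T * ∑ j, B.r i j) := by
        refine Finset.sum_le_sum fun j _ => mul_le_mul_of_nonneg_left ?_
          (B.trans_nonneg i k le_rfl j)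
        refine (ih _ (by omega) j).trans (mul_le_mul_of_nonneg_right ?_ hR)
        exact_mod_cast (show T + 1 - B.L i k ≤ T by omega)
      rw [← Finset.sum_mul, B.sum_trans, one_mul] at h1
      have h2 := Finset.single_le_sum (fun j _ => B.r_nonneg i j) (Finset.mem_univ k)
      push_cast
      linarith

theorem isBoundedUnder_repeatValue (i : Fin n) (k : Fin (K i)) :
    IsBoundedUnder (· ≤ ·) atTop fun T : ℕ => B.repeatValue i T k / (T : ℝ) := by
  refine isBoundedUnder_of ⟨∑ j, B.r i j, fun T => ?_⟩
  exact div_le_of_le_mul₀ (Nat.cast_nonneg _) (Finset.sum_nonneg fun j _ => B.r_nonneg i j)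
    (by rw [mul_comm]; exact B.repeatValue_le i T k)

/-- With `f i k 1 = 0` the arm never leaves `k`. Since a play pays at its beginning, a last play cut
off by the horizon counts in full, so no error term appears. -/
theorem mul_le_repeatValue (i : Fin n) (k : Fin (K i)) (hf : B.f i k 1 = 0) {ρ : ℝ}
    (hρ : 0 ≤ ρ) (hr : (B.L i k : ℝ) * ρ ≤ B.r i k) (T : ℕ) :
    T * ρ ≤ B.repeatValue i T k := by
  induction T using Nat.strong_induction_on with
  | _ T ih =>
    cases T with
    | zero => simp [repeatValue]
    | succ T =>
      rw [repeatValue, B.sum_trans_mul, hf, zero_mul, add_zero]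
      have hL := B.L_pos i k
      have := ih (T + 1 - B.L i k) (by omega)
      -- Only an inequality: the subtraction truncates when the play outlasts the horizon.
      have h2 : ((T + 1 : ℕ) : ℝ) ≤ B.L i k + (T + 1 - B.L i k : ℕ) := by
        exact_mod_cast (show T + 1 ≤ B.L i k + (T + 1 - B.L i k) by omega)
      nlinarith

theorem lucrative_of_f_eq_zero {D : DualSolution K} (hD : B.BalanceFeasible D) (i : Fin n)
    (k : Fin (K i)) (hf : B.f i k 1 = 0) (hr : (B.L i k : ℝ) * (D.lam + D.h i) ≤ B.r i k) :
    B.Lucrative D i k := by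
  refine le_liminf_of_le (B.isBoundedUnder_repeatValue i k).isCoboundedUnder_ge ?_
  filter_upwards [eventually_gt_atTop 0] with T hT
  have hT' : (0 : ℝ) < T := by exact_mod_cast hT
  rw [le_div_iff₀ hT', mul_comm]
  exact B.mul_le_repeatValue i k hf (add_nonneg hD.lam_nonneg (hD.h_nonneg i)) hr T

/-! ### Complementary slackness -/

/-- The constraints of the balanced program for arm `i`, with another potential. -/
def ArmFeasible (D : DualSolution K) (i : Fin n) (p : Fin (K i) → ℝ) : Prop :=
  ∀ k, ∀ t ∈ B.W i k, B.r i k + B.f i k t * (∑ j with j ≠ k, B.q i k j * (p j - p k)) ≤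
    (B.L i k : ℝ) * (D.lam + D.h i) + ((t : ℝ) - 1) * D.h i

/-- All constraints of the balanced program for arm `i` and state `k` are strict, with another
potential. -/
def StateSlack (D : DualSolution K) (i : Fin n) (p : Fin (K i) → ℝ) (k : Fin (K i)) : Prop :=
  ∀ t ∈ B.W i k, B.r i k + B.f i k t * (∑ j with j ≠ k, B.q i k j * (p j - p k)) <
    (B.L i k : ℝ) * (D.lam + D.h i) + ((t : ℝ) - 1) * D.h i

variable {B}

/-- This handles the constraints that no potential can influence. By monotonicity `f` vanishes at
`1` too, and then `r ≥ L (λ + h i)` would put the arm into `U₁`. -/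
theorem lt_of_f_eq_zero {D : DualSolution K} (hD : B.BalanceFeasible D) {i : Fin n}
    (hi : i ∉ B.U₁ D) (hh : 0 < D.h i) (k : Fin (K i)) {t : ℕ} (ht : 1 ≤ t)
    (hf : B.f i k t = 0) :
    B.r i k < (B.L i k : ℝ) * (D.lam + D.h i) + ((t : ℝ) - 1) * D.h i := by
  have hf1 : B.f i k 1 = 0 :=
    le_antisymm ((B.f_le_f i k le_rfl ht).trans hf.le) (B.f_nonneg i k 1 le_rfl)
  have h1 : B.r i k < (B.L i k : ℝ) * (D.lam + D.h i) := by
    by_contra h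
    refine hi ?_
    simp only [U₁, Finset.mem_filter, Finset.mem_univ, true_and]
    exact ⟨k, B.lucrative_of_f_eq_zero hD i k hf1 (not_lt.1 h)⟩
  have h2 : (1 : ℝ) ≤ t := by exact_mod_cast ht
  nlinarith [mul_nonneg (sub_nonneg.2 h2) hh.le]

/-- Slackness propagates along the edges, backwards: lower the potential at the head. -/
theorem exists_stateSlack_of_edge {D : DualSolution K} (hD : B.BalanceFeasible D) {i : Fin n}
    (hi : i ∉ B.U₁ D) (hh : 0 < D.h i) {j k : Fin (K i)} (hjk : 0 < B.q i j k)
    (hk : ∃ p, B.ArmFeasible D i p ∧ B.StateSlack D i p k) :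
    ∃ p, B.ArmFeasible D i p ∧ B.StateSlack D i p j := by
  obtain ⟨p, hp, hs⟩ := hk
  rcases eq_or_ne j k with rfl | hne
  · exact ⟨p, hp, hs⟩
  -- Lowering `p k` can hurt only the constraints of `k` itself; they are strict and survive a small
  -- change.
  have hev : ∀ᶠ ε in nhdsWithin (0 : ℝ) (Set.Ioi 0), ∀ t ∈ B.W i k,
      B.r i k + B.f i k t * (∑ l with l ≠ k, B.q i k l * (p l - (p k - ε))) <
        (B.L i k : ℝ) * (D.lam + D.h i) + ((t : ℝ) - 1) * D.h i := by
    refine (Filter.eventually_all_finset _).2 fun t ht => ?_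
    refine Filter.Eventually.filter_mono nhdsWithin_le_nhds ?_
    refine ContinuousAt.eventually_lt (by fun_prop) (by fun_prop) ?_
    simpa using hs t ht
  obtain ⟨ε, hε, hε0⟩ := (hev.and self_mem_nhdsWithin).exists
  have hε0 : 0 < ε := hε0
  have hother : ∀ l, l ≠ k → ∑ m with m ≠ l, B.q i l m *
      (Function.update p k (p k - ε) m - Function.update p k (p k - ε) l) =
      ∑ m with m ≠ l, B.q i l m * (p m - p l) - ε * B.q i l k := by
    intro l hl
    have : ∀ m, B.q i l m * (Function.update p k (p k - ε) m -
        Function.update p k (p k - ε) l) =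
        B.q i l m * (p m - p l) - if m = k then ε * B.q i l k else 0 := by
      intro m
      rw [Function.update_of_ne hl]
      split_ifs with h
      · subst h; rw [Function.update_self]; ring
      · rw [Function.update_of_ne h]; ring
    simp only [this, Finset.sum_sub_distrib]
    rw [Finset.sum_ite_eq' _ k, if_pos (by simp [hl.symm])]
  have hsame : ∑ m with m ≠ k, B.q i k m *
      (Function.update p k (p k - ε) m - Function.update p k (p k - ε) k) =
      ∑ m with m ≠ k, B.q i k m * (p m - (p k - ε)) := by
    refine Finset.sum_congr rfl fun m hm => ?_
    rw [Function.update_of_ne (Finset.mem_filter.1 hm).2, Function.update_self]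
  refine ⟨Function.update p k (p k - ε), fun l t ht => ?_, fun t ht => ?_⟩
  · rcases eq_or_ne l k with rfl | hl
    · rw [hsame]
      exact (hε t ht).le
    · rw [hother l hl]
      have h1 := hp l t ht
      have h2 := mul_nonneg (B.f_nonneg i l t (B.W_pos i l t ht))
        (mul_nonneg hε0.le (B.q_nonneg i l k))
      linarith
  · rw [hother j hne]
    have ht1 := B.W_pos i j t ht
    rcases (B.f_nonneg i j t ht1).eq_or_lt with h0 | h0
    · rw [← h0, zero_mul, add_zero]
      exact lt_of_f_eq_zero hD hi hh j ht1 h0.symm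
    · have h1 := hp j t ht
      have h2 := mul_pos h0 (mul_pos hε0 hjk)
      linarith

/-- Strong connectivity carries slack from `k` back to every state. The midpoint of two feasible
potentials is slack wherever one of them is, so the states can be collected one by one. -/
theorem exists_forall_stateSlack {D : DualSolution K} (hD : B.BalanceFeasible D) {i : Fin n}
    (hi : i ∉ B.U₁ D) (hh : 0 < D.h i) {k : Fin (K i)} (hk : B.StateSlack D i (D.p i) k) :
    ∃ p, ∀ j, B.StateSlack D i p j := by
  have hDi : B.ArmFeasible D i (D.p i) := fun k t ht => hD.main i k t ht
  have hone : ∀ j, ∃ p, B.ArmFeasible D i p ∧ B.StateSlack D i p j := by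
    intro j
    induction B.q_connected i j k using Relation.ReflTransGen.head_induction_on with
    | refl => exact ⟨D.p i, hDi, hk⟩
    | head h _ ih => exact exists_stateSlack_of_edge hD hi hh h ih
  have hall : ∀ S : Finset (Fin (K i)), ∃ p, B.ArmFeasible D i p ∧
      ∀ j ∈ S, B.StateSlack D i p j := by
    intro S
    induction S using Finset.induction_on with
    | empty => exact ⟨D.p i, hDi, by simp⟩
    | insert l S _ ih =>
      obtain ⟨p₁, h₁, hs₁⟩ := ih
      obtain ⟨p₂, h₂, hs₂⟩ := hone l
      have hmid : ∀ m, ∑ j with j ≠ m, B.q i m j * ((p₁ j + p₂ j) / 2 - (p₁ m + p₂ m) / 2) =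
          ((∑ j with j ≠ m, B.q i m j * (p₁ j - p₁ m)) +
            ∑ j with j ≠ m, B.q i m j * (p₂ j - p₂ m)) / 2 := by
        intro m
        rw [← Finset.sum_add_distrib, Finset.sum_div]
        exact Finset.sum_congr rfl fun j _ => by ring
      refine ⟨fun j => (p₁ j + p₂ j) / 2, fun m t ht => ?_, fun m hm t ht => ?_⟩
      · rw [hmid]
        linarith [h₁ m t ht, h₂ m t ht]
      · rw [hmid]
        rcases Finset.mem_insert.1 hm with rfl | hm
        · linarith [h₁ m t ht, hs₂ t ht]
        · linarith [hs₁ m hm t ht, h₂ m t ht]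
  obtain ⟨p, -, hp⟩ := hall Finset.univ
  exact ⟨p, fun j => hp j (Finset.mem_univ j)⟩

theorem BalanceFeasible.balanceObj_eq {D : DualSolution K} (hD : B.BalanceFeasible D) :
    B.balanceObj D = 2 * (B.M * D.lam) := by
  rw [balanceObj, ← hD.balance, two_mul]

/-- If all constraints of one state were strict, those of the whole arm could be made so. Its `h i`
could then pay for a decrease of `λ`, against optimality, as the objective is `2 M λ`. -/
theorem BalanceOptimal.exists_tight {D : DualSolution K} (hD : B.BalanceOptimal D) {i : Fin n}
    (hi : i ∉ B.U₁ D) (hh : 0 < D.h i) (k : Fin (K i)) :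
    ∃ t ∈ B.W i k, B.Tight D i k t := by
  by_contra! hnt
  obtain ⟨p, hp⟩ := exists_forall_stateSlack hD.1 hi hh (k := k) fun t ht =>
    lt_of_le_of_ne (hD.1.main i k t ht) fun h => hnt t ht h.symm
  have hM : (1 : ℝ) ≤ B.M := by exact_mod_cast B.M_pos
  have hn : (1 : ℝ) ≤ n := by exact_mod_cast i.pos
  have hN : (0 : ℝ) < B.M + n - 1 := by linarith
  have hlam : 0 < D.lam := by
    have h1 := Finset.single_le_sum (fun l _ => hD.1.h_nonneg l) (Finset.mem_univ i)
    rw [← hD.1.balance] at h1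
    by_contra h
    nlinarith [hD.1.lam_nonneg]
  have hev : ∀ᶠ μ in nhdsWithin (0 : ℝ) (Set.Ioi 0), (∀ j, ∀ t ∈ B.W i j,
      B.r i j + B.f i j t * (∑ l with l ≠ j, B.q i j l * (p l - p j)) <
        (B.L i j : ℝ) * ((D.lam - μ) + (D.h i - (B.M + n - 1) * μ)) +
          ((t : ℝ) - 1) * (D.h i - (B.M + n - 1) * μ)) ∧ 0 < D.lam - μ ∧
          0 < D.h i - (B.M + n - 1) * μ := by
    refine Filter.Eventually.filter_mono nhdsWithin_le_nhds (((eventually_all).2 fun j =>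
      (Filter.eventually_all_finset _).2 fun t ht => ?_).and (Eventually.and ?_ ?_))
    · refine ContinuousAt.eventually_lt (by fun_prop) (by fun_prop) ?_
      simpa using hp j t ht
    · exact ContinuousAt.eventually_lt (by fun_prop) (by fun_prop) (by simpa using hlam)
    · exact ContinuousAt.eventually_lt (by fun_prop) (by fun_prop) (by simpa using hh)
  obtain ⟨μ, ⟨hμ, hμl, hμh⟩, hμ0⟩ := (hev.and self_mem_nhdsWithin).exists
  have hμ0 : 0 < μ := hμ0
  -- The other arms keep `λ + h l`. Arm `i` pays `(M + n - 1) μ`: the `n - 1` increases by `μ`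
  -- elsewhere, and the decrease `M μ` of `M λ`.
  let D' : DualSolution K := ⟨D.lam - μ,
    fun l => D.h l + μ - if l = i then (B.M + n) * μ else 0, Function.update D.p i p⟩
  have hD' : B.BalanceFeasible D' := by
    refine ⟨fun l j t ht => ?_, ?_, hμl.le, fun l => ?_⟩
    · rcases eq_or_ne l i with rfl | hl
      · have := (hμ j t ht).le
        simp only [D', deltaP, if_true, Function.update_self]
        linarith
      · have h1 := hD.1.main l j t ht
        have h2 : (0 : ℝ) ≤ ((t : ℝ) - 1) * μ :=
          mul_nonneg (sub_nonneg.2 (by exact_mod_cast B.W_pos l j t ht)) hμ0.le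
        simp only [D', deltaP, if_neg hl, Function.update_of_ne hl] at h1 ⊢
        linarith
    · simp only [D', Finset.sum_sub_distrib, Finset.sum_add_distrib, Finset.sum_ite_eq',
        Finset.mem_univ, if_true, Finset.sum_const, Finset.card_univ, Fintype.card_fin,
        nsmul_eq_mul]
      linarith [hD.1.balance]
    · rcases eq_or_ne l i with rfl | hl
      · simp only [D', if_true]
        linarith
      · simp only [D', if_neg hl]
        linarith [hD.1.h_nonneg l]
  have h1 := hD.2 D' hD'
  rw [hD.1.balanceObj_eq, hD'.balanceObj_eq] at h1
  have h2 : D'.lam = D.lam - μ := rfl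
  rw [h2] at h1
  nlinarith

/-- In a good state the left side does not increase with `t` while the right side strictly
increases, so tightness after `1` would violate the constraint at `1`. -/
theorem BalanceFeasible.eq_one_of_tight {D : DualSolution K} (hD : B.BalanceFeasible D)
    {i : Fin n} (hh : 0 < D.h i) {k : Fin (K i)} (hg : B.Good D i k) {t : ℕ} (ht : t ∈ B.W i k)
    (htt : B.Tight D i k t) : t = 1 := by
  have h1 := B.W_pos i k t ht
  by_contra hne
  have h2 : (2 : ℝ) ≤ t := by exact_mod_cast (show 2 ≤ t by omega)
  have h3 := hD.main i k 1 (B.one_mem_W i k)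
  have h4 := B.f_le_f i k le_rfl h1
  have h5 := mul_le_mul_of_nonpos_right h4 (le_of_lt hg)
  unfold Tight at htt
  norm_num at h3
  nlinarith

end MonotoneBandit
end
-- Invariants and drift under the balanced index rules
noncomputable section

namespace MonotoneBandit

variable {n : ℕ} {K : Fin n → ℕ} (B : MonotoneBandit n K)

/-! ### The arms that are played continuously -/

/-- Expected reward in the coming `T` steps from an arm that is played over and over. -/
def repeatGain (i : Fin n) (T : ℕ) (c : ArmStatus (K i)) : ℝ :=
  if c.rem = 0 then B.repeatValue i T c.state
  else ∑ j, B.trans i c.state c.elapsed j * B.repeatValue i (T - c.rem) j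

theorem armExp_repeatGain {i : Fin n} (T : ℕ) {c : ArmStatus (K i)} {play : Prop}
    [Decidable play] (h : B.occupied i c play ≠ 0) :
    B.armExp i c play (B.repeatGain i T) =
      ∑ j, B.trans i c.state c.elapsed j * B.repeatValue i (T + 1 - B.occupied i c play) j := by
  rcases eq_or_ne (B.occupied i c play) 1 with h1 | h1
  · rw [B.armExp_of_occupied h1, h1]
    simp [repeatGain]
  · have h2 : 2 ≤ B.occupied i c play := by omega
    rw [B.armExp_of_two_le h2, repeatGain, if_neg (show B.occupied i c play - 1 ≠ 0 by omega)]
    simp only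
    rw [show T - (B.occupied i c play - 1) = T + 1 - B.occupied i c play by omega]

theorem armExp_repeatGain_of_play {i : Fin n} (T : ℕ) {c : ArmStatus (K i)} {play : Prop}
    [Decidable play] (hr : c.rem = 0) (hp : play) (he : c.elapsed = 1) :
    B.r i c.state + B.armExp i c play (B.repeatGain i T) = B.repeatGain i (T + 1) c := by
  have ho := B.occupied_of_play hr hp
  have := B.L_pos i c.state
  rw [B.armExp_repeatGain T (by omega), ho, repeatGain, if_pos hr, repeatValue, he]

theorem armExp_repeatGain_of_busy {i : Fin n} (T : ℕ) {c : ArmStatus (K i)} {play : Prop}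
    [Decidable play] (hr : c.rem ≠ 0) :
    B.armExp i c play (B.repeatGain i T) = B.repeatGain i (T + 1) c := by
  have ho := B.occupied_of_busy (play := play) hr
  rw [B.armExp_repeatGain T (by omega), ho, repeatGain, if_neg hr]

/-! ### Invariants of the balanced index policy -/

open Classical in
/-- The arms of `U₂` that are in a good state. -/
def goodArms (D : DualSolution K) (c : BanditConfig K) : Finset (Fin n) :=
  (B.U₂ D).filter fun i => B.Good D i (c i).state

theorem mem_goodArms {D : DualSolution K} {c : BanditConfig K} {i : Fin n} :
    i ∈ B.goodArms D c ↔ i ∈ B.U₂ D ∧ B.Good D i (c i).state := by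
  classical
  exact Finset.mem_filter

/-- Properties of the situations that occur under a balanced index policy. -/
structure IndexInvariant (D : DualSolution K) (A : Finset (Fin n)) (c : BanditConfig K) :
    Prop where
  elapsed_of_mem : ∀ i ∈ A, (c i).elapsed = 1
  card_le : (busy c ∪ A).card ≤ B.M
  busy_subset : (B.U₁ D).card < B.M → busy c ⊆ A ∪ B.U₂ D
  elapsed_of_good : (B.U₁ D).card < B.M → ∀ i, B.AvailGood D c i → (c i).elapsed = 1
  card_good_le : (B.U₁ D).card < B.M → (busy c ∪ A ∪ B.goodArms D c).card ≤ B.M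

variable {B}

theorem disjoint_of_legal {c : BanditConfig K} {a : Finset (Fin n)} (h : B.Legal c a) :
    Disjoint a (busy c) :=
  Finset.disjoint_left.2 fun i hi hb => (Finset.mem_filter.1 hb).2 (h.1 i hi)

theorem not_mem_busy {c : BanditConfig K} {i : Fin n} : i ∉ busy c ↔ (c i).rem = 0 := by
  simp [busy]

theorem IndexInvariant.card_busy_le {D : DualSolution K} {A : Finset (Fin n)}
    {c : BanditConfig K} (h : B.IndexInvariant D A c) : (busy c).card ≤ B.M :=
  (Finset.card_le_card Finset.subset_union_left).trans h.card_le

/-- There are always enough players for all good arms. -/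
theorem IndexInvariant.mem_of_availGood {D : DualSolution K} {A : Finset (Fin n)}
    {c : BanditConfig K} {a : Finset (Fin n)} (h : B.IndexInvariant D A c)
    (hU : (B.U₁ D).card < B.M) (hleg : B.Legal c a) (ha : B.BalancedIndexAction D A c a)
    {j : Fin n} (hj : B.AvailGood D c j) : j ∈ a := by
  by_contra hja
  have hready : ∀ i ∈ a, ¬ B.AvailReady D c i := fun i hi hr => hja (ha.exploit ⟨i, hi, hr⟩ j hj)
  have hcard : B.M - (busy c).card ≤ a.card := by
    by_contra hlt
    exact hja (ha.idle hU (not_le.1 hlt) j (Or.inl hj))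
  -- If `j` is left over, no ready arm is played and no player is free, so the left side has more
  -- than `M` elements, against `card_good_le`.
  have hsub : insert j (a ∪ busy c) ⊆ busy c ∪ A ∪ B.goodArms D c := by
    have hgood : ∀ i, B.AvailGood D c i → i ∈ B.goodArms D c := fun i hi =>
      B.mem_goodArms.2 ⟨hi.1, hi.2.2⟩
    intro i hi
    simp only [Finset.mem_insert, Finset.mem_union] at hi ⊢
    rcases hi with rfl | hi | hi
    · exact Or.inr (hgood i hj)
    · rcases ha.only i hi with hA | ⟨-, hg | hr⟩
      · exact Or.inl (Or.inr hA)
      · exact Or.inr (hgood i hg)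
      · exact absurd hr (hready i hi)
    · exact Or.inl (Or.inl hi)
  have h1 := (Finset.card_le_card hsub).trans (h.card_good_le hU)
  rw [Finset.card_insert_of_notMem (by
      rw [Finset.mem_union, not_or]; exact ⟨hja, not_mem_busy.2 hj.2.1⟩),
    Finset.card_union_of_disjoint (disjoint_of_legal hleg)] at h1
  omega

theorem subset_union_busy_of_action {D : DualSolution K} {A : Finset (Fin n)}
    {c : BanditConfig K} {a : Finset (Fin n)} (ha : B.BalancedIndexAction D A c a) :
    A ⊆ a ∪ busy c := by
  intro i hi
  by_cases hr : (c i).rem = 0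
  · exact Finset.mem_union_left _ (ha.continuous i hi hr)
  · exact Finset.mem_union_right _ (by simp [busy, hr])

theorem union_busy_subset_of_action {D : DualSolution K} {A : Finset (Fin n)}
    {c : BanditConfig K} {a : Finset (Fin n)} (h : B.IndexInvariant D A c)
    (hU : (B.U₁ D).card < B.M) (ha : B.BalancedIndexAction D A c a) :
    a ∪ busy c ⊆ A ∪ B.U₂ D := by
  refine Finset.union_subset (fun i hi => ?_) (h.busy_subset hU)
  rw [Finset.mem_union]
  rcases ha.only i hi with hA | ⟨-, hg | hr⟩
  · exact Or.inl hA
  · exact Or.inr hg.1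
  · exact Or.inr hr.1

/-- An unoccupied arm keeps its state, and every idle good arm is played. So an arm of `U₂` that is
good after the step was occupied during it, and at most `M` arms were. -/
theorem IndexInvariant.next {D : DualSolution K} {A : Finset (Fin n)} {c : BanditConfig K}
    {a : Finset (Fin n)} (h : B.IndexInvariant D A c) (hleg : B.Legal c a)
    (ha : B.BalancedIndexAction D A c a) (s : ∀ i, Fin (K i)) :
    B.IndexInvariant D A (B.next c a s) := by
  have hcard := B.card_union_busy_le hleg h.card_busy_le
  have hA := subset_union_busy_of_action ha
  have hbusy := B.busy_next_subset c a s
  have hne : ∀ i, i ∈ a ∪ busy c → B.next c a s i =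
      if B.occupied i (c i) (i ∈ a) = 1 then ⟨s i, 1, 0⟩
      else ⟨(c i).state, (c i).elapsed, B.occupied i (c i) (i ∈ a) - 1⟩ := by
    intro i hi
    simp only [MonotoneBandit.next, armNext]
    rw [if_neg (B.occupied_ne_zero_iff.2 hi)]
  have hidle : ∀ i, i ∉ a ∪ busy c →
      B.next c a s i = ⟨(c i).state, (c i).elapsed + 1, 0⟩ := by
    intro i hi
    simp only [MonotoneBandit.next, armNext]
    rw [if_pos (by_contra fun h => hi (B.occupied_ne_zero_iff.1 h))]
  have hgood : (B.U₁ D).card < B.M → B.goodArms D (B.next c a s) ⊆ a ∪ busy c := by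
    intro hU i hi
    by_contra hn
    obtain ⟨hi2, hg⟩ := B.mem_goodArms.1 hi
    rw [hidle i hn] at hg
    rw [Finset.mem_union, not_or, not_mem_busy] at hn
    exact hn.1 (h.mem_of_availGood hU hleg ha ⟨hi2, hn.2, hg⟩)
  refine ⟨fun i hi => ?_, ?_, fun hU => ?_, fun hU i hi => ?_, fun hU => ?_⟩
  · rw [hne i (hA hi)]
    split_ifs
    · rfl
    · exact h.elapsed_of_mem i hi
  · exact (Finset.card_le_card (Finset.union_subset hbusy hA)).trans hcard
  · exact hbusy.trans (union_busy_subset_of_action h hU ha)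
  · have hm := hgood hU (B.mem_goodArms.2 ⟨hi.1, hi.2.2⟩)
    have h0 := hi.2.1
    have hocc := B.occupied_ne_zero_iff.2 hm
    rw [hne i hm] at h0 ⊢
    split_ifs with h1
    · rfl
    · rw [if_neg h1] at h0
      simp only at h0
      omega
  · exact (Finset.card_le_card (Finset.union_subset (Finset.union_subset hbusy hA)
      (hgood hU))).trans hcard

theorem indexInvariant_start {D : DualSolution K} {A : Finset (Fin n)} {s : ∀ i, Fin (K i)}
    (hcard : A.card = min B.M (B.U₁ D).card)
    (hgood : (B.U₁ D).card < B.M → (B.goodArms D (start s)).card ≤ B.M - (B.U₁ D).card) :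
    B.IndexInvariant D A (start s) := by
  have hb : busy (start s) = ∅ := by simp [busy, start]
  refine ⟨fun _ _ => rfl, ?_, fun _ => ?_, fun _ _ _ => rfl, fun hU => ?_⟩
  · rw [hb, Finset.empty_union, hcard]; exact min_le_left _ _
  · rw [hb]; exact Finset.empty_subset _
  · rw [hb, Finset.empty_union]
    have := Finset.card_union_le A (B.goodArms D (start s))
    have := hgood hU
    omega

theorem Policy.Reachable.indexInvariant {π : B.Policy} {s : ∀ i, Fin (K i)}
    {D : DualSolution K} {A : Finset (Fin n)} (h0 : B.IndexInvariant D A (start s))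
    (hact : ∀ H c a, π.Reachable s H c → π.law H c a ≠ 0 → B.BalancedIndexAction D A c a)
    {H : BanditHistory K} {c : BanditConfig K} (h : π.Reachable s H c) :
    B.IndexInvariant D A c :=
  h.invariant h0 fun H c a s' hr hc ha => hc.next (π.legal H c a ha) (hact H c a hr ha) s'

/-! ### The arms in `U₂` -/

variable (B)

/-- The smallest breakpoint whose constraint is tight. -/
def readyTime (D : DualSolution K) (i : Fin n) (k : Fin (K i)) : ℕ :=
  sInf {t | t ∈ B.W i k ∧ B.Tight D i k t}

open Classical in
/-- Credit for the idle period: an arm of `U₂` that is not good collects `h i` in each step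
until it becomes ready. -/
def credit (D : DualSolution K) (i : Fin n) (k : Fin (K i)) (t : ℕ) : ℝ :=
  if B.Good D i k then 0 else ((min t (B.readyTime D i k) - 1 : ℕ) : ℝ) * D.h i

theorem credit_one (D : DualSolution K) (i : Fin n) (k : Fin (K i)) : B.credit D i k 1 = 0 := by
  have : min 1 (B.readyTime D i k) - 1 = 0 := by omega
  simp [credit, this]

variable {B}

theorem disjoint_U₁_U₂ (D : DualSolution K) : Disjoint (B.U₁ D) (B.U₂ D) := by
  rw [Finset.disjoint_right]
  intro i hi
  exact (Finset.mem_filter.1 hi).2.1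

theorem BalanceOptimal.isLeast_readyTime {D : DualSolution K} (hD : B.BalanceOptimal D)
    {i : Fin n} (hi : i ∈ B.U₂ D) (k : Fin (K i)) :
    IsLeast {t | t ∈ B.W i k ∧ B.Tight D i k t} (B.readyTime D i k) := by
  obtain ⟨-, h1, h2⟩ := Finset.mem_filter.1 hi
  obtain ⟨t, ht⟩ := hD.exists_tight h1 h2 k
  exact ⟨Nat.sInf_mem ⟨t, ht⟩, fun _ h => Nat.sInf_le h⟩

/-- A good arm is played at `elapsed = 1`, where its constraint is tight. A ready arm is played at
or after its tight time: its credit is capped there, and the later `f` is no loss as `deltaP ≥ 0`. A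
running play gains exactly `λ + h i`. -/
theorem BalanceOptimal.drift_of_mem {D : DualSolution K} (hD : B.BalanceOptimal D)
    {A : Finset (Fin n)} {c : BanditConfig K} {a : Finset (Fin n)}
    (h : B.IndexInvariant D A c) (hAU : A ⊆ B.U₁ D) (hU : (B.U₁ D).card < B.M)
    (hleg : B.Legal c a)
    (ha : B.BalancedIndexAction D A c a) {i : Fin n} (hi : i ∈ B.U₂ D) (hm : i ∈ a ∪ busy c) :
    B.potential D i (B.credit D i) (c i) + (D.lam + D.h i) ≤
      (if i ∈ a then B.r i (c i).state else 0) +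
        B.armExp i (c i) (i ∈ a) (B.potential D i (B.credit D i)) := by
  obtain ⟨-, -, hh⟩ := Finset.mem_filter.1 hi
  by_cases hia : i ∈ a
  · rw [B.armExp_potential_of_play D (B.credit_one D i) (hleg.1 i hia) hia, if_pos hia]
    obtain ⟨⟨hW, htight⟩, -⟩ := hD.isLeast_readyTime hi (c i).state
    rcases ha.only i hia with hA | ⟨-, hg | hr⟩
    · exact absurd hi (Finset.disjoint_left.1 (disjoint_U₁_U₂ D) (hAU hA))
    · rw [h.elapsed_of_good hU i hg, credit_one]
      rw [hD.1.eq_one_of_tight hh hg.2.2 hW htight] at htight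
      unfold Tight at htight
      norm_num at htight
      linarith
    · obtain ⟨hΔ, t₀, ht₀, hle⟩ := hr.2.2
      rw [ht₀.unique (hD.isLeast_readyTime hi (c i).state)] at hle
      have h1 := B.W_pos i _ _ hW
      rw [credit, if_neg (show ¬ B.Good D i (c i).state from not_lt.2 hΔ), min_eq_right hle, Nat.cast_sub h1, Nat.cast_one]
      have h2 := mul_le_mul_of_nonneg_right (B.f_le_f i (c i).state h1 hle) hΔ
      unfold Tight at htight
      linarith
  · have hr : (c i).rem ≠ 0 := by
      have := (Finset.mem_union.1 hm).resolve_left hia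
      exact (Finset.mem_filter.1 this).2
    rw [B.armExp_potential_of_busy D (B.credit_one D i) hr, if_neg hia, zero_add]

theorem BalanceOptimal.drift_of_not_mem {D : DualSolution K} (hD : B.BalanceOptimal D)
    {c : BanditConfig K} {a : Finset (Fin n)} {i : Fin n} (hm : i ∉ a ∪ busy c) :
    B.potential D i (B.credit D i) (c i) ≤
      (if i ∈ a then B.r i (c i).state else 0) +
        B.armExp i (c i) (i ∈ a) (B.potential D i (B.credit D i)) := by
  rw [Finset.mem_union, not_or, not_mem_busy] at hm
  rw [B.armExp_potential_of_idle D hm.2 hm.1, if_neg hm.1, zero_add, le_add_iff_nonneg_right,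
    sub_nonneg]
  unfold credit
  split_ifs
  · exact le_rfl
  · refine mul_le_mul_of_nonneg_right ?_ (hD.1.h_nonneg i)
    exact_mod_cast (by omega)

/-- The idle time is strictly below the cap of the credit, so the coming step still adds `h i`. -/
theorem BalanceOptimal.drift_of_not_ready {D : DualSolution K} (hD : B.BalanceOptimal D)
    {c : BanditConfig K} {a : Finset (Fin n)} (hc : ∀ i, 1 ≤ (c i).elapsed)
    {i : Fin n} (hi : i ∈ B.U₂ D) (hm : i ∉ a ∪ busy c) (hg : ¬ B.AvailGood D c i)
    (hr : ¬ B.AvailReady D c i) :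
    B.potential D i (B.credit D i) (c i) + D.h i ≤
      (if i ∈ a then B.r i (c i).state else 0) +
        B.armExp i (c i) (i ∈ a) (B.potential D i (B.credit D i)) := by
  rw [Finset.mem_union, not_or, not_mem_busy] at hm
  have hg' : ¬ B.Good D i (c i).state := fun h => hg ⟨hi, hm.2, h⟩
  have hlt : (c i).elapsed < B.readyTime D i (c i).state := by
    by_contra hle
    exact hr ⟨hi, hm.2, not_lt.1 hg', _, hD.isLeast_readyTime hi _, not_lt.1 hle⟩
  rw [B.armExp_potential_of_idle D hm.2 hm.1, if_neg hm.1, zero_add]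
  rw [credit, credit, if_neg hg', if_neg hg', min_eq_left hlt.le,
    min_eq_left (show (c i).elapsed + 1 ≤ _ from hlt), Nat.add_sub_cancel,
    Nat.cast_sub (hc i), Nat.cast_one]
  linarith

/-- In each step, the arms of `U₂` gain at least the share of the players left for them, or
the sum of their `h`. -/
theorem BalanceOptimal.drift_sum {D : DualSolution K} (hD : B.BalanceOptimal D)
    {A : Finset (Fin n)} {c : BanditConfig K} {a : Finset (Fin n)}
    (hc : ∀ i, 1 ≤ (c i).elapsed)
    (h : B.IndexInvariant D A c) (hAU : A ⊆ B.U₁ D) (hU : (B.U₁ D).card < B.M)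
    (hleg : B.Legal c a) (ha : B.BalancedIndexAction D A c a) :
    min (((B.M : ℝ) - A.card) * D.lam) (∑ i ∈ B.U₂ D, D.h i) +
      ∑ i ∈ B.U₂ D, B.potential D i (B.credit D i) (c i) ≤
      ∑ i ∈ B.U₂ D, ((if i ∈ a then B.r i (c i).state else 0) +
        B.armExp i (c i) (i ∈ a) (B.potential D i (B.credit D i))) := by
  classical
  -- If a ready arm is left over, all players are occupied, at least `M - |A|` of them with arms of
  -- `U₂`. Otherwise each arm of `U₂` is occupied or still waits to become ready.
  by_cases hex : ∃ j, B.AvailReady D c j ∧ j ∉ a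
  · obtain ⟨j, hj, hja⟩ := hex
    have hcard : B.M - (busy c).card ≤ a.card := by
      by_contra hlt
      exact hja (ha.idle hU (not_le.1 hlt) j (Or.inr hj))
    have hM : B.M ≤ (a ∪ busy c).card := by
      rw [Finset.card_union_of_disjoint (disjoint_of_legal hleg)]
      omega
    have hsub : a ∪ busy c ⊆ A ∪ (B.U₂ D).filter (· ∈ a ∪ busy c) := by
      intro i hi
      have := union_busy_subset_of_action h hU ha hi
      rw [Finset.mem_union] at this ⊢
      exact this.imp_right fun h2 => Finset.mem_filter.2 ⟨h2, hi⟩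
    have hle : B.M ≤ A.card + ((B.U₂ D).filter (· ∈ a ∪ busy c)).card :=
      hM.trans ((Finset.card_le_card hsub).trans (Finset.card_union_le _ _))
    have hle' : (B.M : ℝ) - A.card ≤ ((B.U₂ D).filter (· ∈ a ∪ busy c)).card := by
      rw [sub_le_iff_le_add']
      exact_mod_cast hle
    calc _ ≤ ((B.U₂ D).filter (· ∈ a ∪ busy c)).card * D.lam +
          ∑ i ∈ B.U₂ D, B.potential D i (B.credit D i) (c i) :=
          add_le_add ((min_le_left _ _).trans
            (mul_le_mul_of_nonneg_right hle' hD.1.lam_nonneg)) le_rfl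
      _ = ∑ i ∈ B.U₂ D, ((if i ∈ a ∪ busy c then D.lam else 0) +
          B.potential D i (B.credit D i) (c i)) := by
          rw [Finset.sum_add_distrib, ← Finset.sum_filter, Finset.sum_const, nsmul_eq_mul]
      _ ≤ _ := by
          refine Finset.sum_le_sum fun i hi => ?_
          by_cases hm : i ∈ a ∪ busy c
          · have := hD.drift_of_mem h hAU hU hleg ha hi hm
            have := hD.1.h_nonneg i
            rw [if_pos hm]
            linarith
          · rw [if_neg hm, zero_add]
            exact hD.drift_of_not_mem hm
  · push Not at hex
    refine (add_le_add (min_le_right _ _) le_rfl).trans ?_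
    rw [← Finset.sum_add_distrib]
    refine Finset.sum_le_sum fun i hi => ?_
    by_cases hm : i ∈ a ∪ busy c
    · have := hD.drift_of_mem h hAU hU hleg ha hi hm
      have := hD.1.lam_nonneg
      linarith
    · rw [add_comm]
      exact hD.drift_of_not_ready hc hi hm
        (fun hg => hm (Finset.mem_union_left _ (h.mem_of_availGood hU hleg ha hg)))
        (fun hr => hm (Finset.mem_union_left _ (hex i hr)))

end MonotoneBandit
end
-- The reward rate of a balanced index policy
noncomputable section

namespace MonotoneBandit

variable {n : ℕ} {K : Fin n → ℕ} {B : MonotoneBandit n K}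

/-! ### The lower bound -/

theorem le_value_of_card_le {D : DualSolution K} {A : Finset (Fin n)} {π : B.Policy}
    {s : ∀ i, Fin (K i)} (h0 : B.IndexInvariant D A (start s))
    (hact : ∀ H c a, π.Reachable s H c → π.law H c a ≠ 0 → B.BalancedIndexAction D A c a)
    (T : ℕ) : ∑ i ∈ A, B.repeatValue i T (s i) ≤ π.value T [] (start s) := by
  refine π.le_value_of_potential (s := s) (fun T c => ∑ i ∈ A, B.repeatGain i T (c i))
    ?_ ?_ T _ _ .init
  · intro H c _
    simp [repeatGain, repeatValue]
  · intro T H c a hc ha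
    have hinv := hc.indexInvariant h0 hact
    have hleg := π.legal H c a ha
    have hA := subset_union_busy_of_action (hact H c a hc ha)
    rw [B.sum_jointProb_mul_sum c a A fun i => B.repeatGain i T]
    have h1 : ∑ i ∈ A, (if i ∈ a then B.r i (c i).state else 0) ≤ B.reward c a := by
      rw [← Finset.sum_filter]
      refine Finset.sum_le_sum_of_subset_of_nonneg (fun i hi => (Finset.mem_filter.1 hi).2) ?_
      exact fun i _ _ => B.r_nonneg i _
    refine le_trans (le_of_eq ?_) (add_le_add h1 le_rfl)
    rw [← Finset.sum_add_distrib]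
    refine Finset.sum_congr rfl fun i hi => ?_
    by_cases hia : i ∈ a
    · rw [if_pos hia, B.armExp_repeatGain_of_play T (hleg.1 i hia) hia (hinv.elapsed_of_mem i hi)]
    · have hr := (Finset.mem_filter.1 ((Finset.mem_union.1 (hA hi)).resolve_left hia)).2
      rw [if_neg hia, B.armExp_repeatGain_of_busy T hr, zero_add]

/-- The arms in `A` are followed by their expected remaining reward, because only their long-run
average is known; those in `U₂` by the potential, which is bounded above thanks to the capped
credit. -/
theorem BalanceOptimal.exists_le_value {D : DualSolution K} (hD : B.BalanceOptimal D)
    {A : Finset (Fin n)} {π : B.Policy} {s : ∀ i, Fin (K i)}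
    (h0 : B.IndexInvariant D A (start s)) (hAU : A ⊆ B.U₁ D) (hU : (B.U₁ D).card < B.M)
    (hact : ∀ H c a, π.Reachable s H c → π.law H c a ≠ 0 → B.BalancedIndexAction D A c a) :
    ∃ C, ∀ T : ℕ, ∑ i ∈ A, B.repeatValue i T (s i) +
      T * min (((B.M : ℝ) - A.card) * D.lam) (∑ i ∈ B.U₂ D, D.h i) - C ≤
      π.value T [] (start s) := by
  classical
  set w := min (((B.M : ℝ) - A.card) * D.lam) (∑ i ∈ B.U₂ D, D.h i)
  let b : ∀ i, Fin (K i) → ℝ := fun i k =>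
    |D.p i k| + |B.deltaP D i k| + B.readyTime D i k * D.h i
  have hb : ∀ i k, 0 ≤ b i k := fun i k => by have := hD.1.h_nonneg i; positivity
  let C := ∑ i ∈ B.U₂ D, ∑ k, b i k
  let Φ : BanditConfig K → ℝ := fun c => ∑ i ∈ B.U₂ D, B.potential D i (B.credit D i) (c i)
  let Ψ : ℕ → BanditConfig K → ℝ := fun T c =>
    ∑ i ∈ A, B.repeatGain i T (c i) + Φ c + (T * w - C)
  have hdisj : Disjoint A (B.U₂ D) := (disjoint_U₁_U₂ D).mono_left hAU
  have hkey := fun T => π.le_value_of_potential (s := s) Ψ ?_ ?_ T _ _ .init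
  · refine ⟨C - Φ (start s), fun T => le_trans (le_of_eq ?_) (hkey T)⟩
    have : ∀ i, B.repeatGain i T (start s i) = B.repeatValue i T (s i) := fun i => by
      simp [repeatGain, start]
    simp only [Ψ, this]
    ring
  · intro H c hc
    have hle : ∀ i, B.potential D i (B.credit D i) (c i) ≤ ∑ k, b i k := by
      intro i
      refine le_trans ?_ (Finset.single_le_sum (fun k _ => hb i k) (Finset.mem_univ (c i).state))
      have h1 := hc.one_le_elapsed i
      have h2 := le_abs_self (D.p i (c i).state)
      have h3 := abs_nonneg (B.deltaP D i (c i).state)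
      have h4 := (abs_le.1 (B.abs_f_mul_le D i (c i).state h1)).2
      have h5 : 0 ≤ ((c i).rem : ℝ) * (D.lam + D.h i) :=
        mul_nonneg (Nat.cast_nonneg _) (add_nonneg hD.1.lam_nonneg (hD.1.h_nonneg i))
      have h6 : 0 ≤ (B.readyTime D i (c i).state : ℝ) * D.h i :=
        mul_nonneg (Nat.cast_nonneg _) (hD.1.h_nonneg i)
      have h7 : B.credit D i (c i).state (c i).elapsed ≤
          (B.readyTime D i (c i).state : ℝ) * D.h i := by
        unfold credit
        split_ifs
        · exact h6
        · refine mul_le_mul_of_nonneg_right ?_ (hD.1.h_nonneg i)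
          exact_mod_cast (by omega)
      simp only [potential, b]
      split_ifs <;> linarith
    have hsum : Φ c ≤ C := Finset.sum_le_sum fun i _ => hle i
    have hz : ∑ i ∈ A, B.repeatGain i 0 (c i) = 0 :=
      Finset.sum_eq_zero fun i _ => by simp [repeatGain, repeatValue]
    simp only [Ψ, hz, Nat.cast_zero]
    linarith
  · intro T H c a hc ha
    have hinv := hc.indexInvariant h0 hact
    have hleg := π.legal H c a ha
    have hbi := hact H c a hc ha
    have hA := subset_union_busy_of_action hbi
    have hdrift := hD.drift_sum hc.one_le_elapsed hinv hAU hU hleg hbi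
    have hgain : ∑ i ∈ A, ((if i ∈ a then B.r i (c i).state else 0) +
        B.armExp i (c i) (i ∈ a) (B.repeatGain i T)) =
        ∑ i ∈ A, B.repeatGain i (T + 1) (c i) := by
      refine Finset.sum_congr rfl fun i hi => ?_
      by_cases hia : i ∈ a
      · rw [if_pos hia,
          B.armExp_repeatGain_of_play T (hleg.1 i hia) hia (hinv.elapsed_of_mem i hi)]
      · have hr := (Finset.mem_filter.1 ((Finset.mem_union.1 (hA hi)).resolve_left hia)).2
        rw [if_neg hia, B.armExp_repeatGain_of_busy T hr, zero_add]
    have hrew : ∑ i ∈ A, (if i ∈ a then B.r i (c i).state else 0) +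
        ∑ i ∈ B.U₂ D, (if i ∈ a then B.r i (c i).state else 0) = B.reward c a := by
      rw [← Finset.sum_union hdisj]
      exact B.sum_ite_reward c a _
        (Finset.subset_union_left.trans (union_busy_subset_of_action hinv hU hbi))
    have hE : ∑ s', B.jointProb c a s' * Ψ T (B.next c a s') =
        ∑ i ∈ A, B.armExp i (c i) (i ∈ a) (B.repeatGain i T) +
        ∑ i ∈ B.U₂ D, B.armExp i (c i) (i ∈ a) (B.potential D i (B.credit D i)) +
        (T * w - C) := by
      rw [← B.sum_jointProb_mul_sum c a A fun i => B.repeatGain i T,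
        ← B.sum_jointProb_mul_sum c a _ fun i => B.potential D i (B.credit D i),
        ← Finset.sum_add_distrib]
      simp only [← mul_add]
      rw [← B.sum_jointProb_mul_add_const]
    rw [hE]
    simp only [Finset.sum_add_distrib] at hdrift hgain
    simp only [Ψ, Φ]
    push_cast
    linarith

theorem sum_h_eq {D : DualSolution K} (hD : B.BalanceFeasible D) :
    ∑ i, D.h i = ∑ i ∈ B.U₁ D, D.h i + ∑ i ∈ B.U₂ D, D.h i := by
  classical
  rw [← Finset.sum_union (disjoint_U₁_U₂ D)]
  refine (Finset.sum_subset (Finset.subset_univ _) fun i _ hi => ?_).symm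
  rw [Finset.mem_union, not_or] at hi
  by_contra hne
  exact hi.2 (Finset.mem_filter.2 ⟨Finset.mem_univ i, hi.1,
    lt_of_le_of_ne (hD.h_nonneg i) (Ne.symm hne)⟩)

/-- The reward rate of a balanced index policy is at least half of the optimal value. -/
theorem BalanceOptimal.exists_rate {D : DualSolution K} (hD : B.BalanceOptimal D)
    {π : B.Policy} {s : ∀ i, Fin (K i)} (hπ : B.IsBalancedIndex D s π) :
    ∃ (A : Finset (Fin n)) (w C : ℝ), (∀ i ∈ A, B.Lucrative D i (s i)) ∧
      (B.M : ℝ) * D.lam ≤ ∑ i ∈ A, (D.lam + D.h i) + w ∧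
      ∀ T : ℕ, ∑ i ∈ A, B.repeatValue i T (s i) + T * w - C ≤ π.value T [] (start s) := by
  obtain ⟨A, hAU, hcard, hluc, hgood, hact⟩ := hπ
  have h0 : B.IndexInvariant D A (start s) := indexInvariant_start hcard hgood
  rcases lt_or_ge (B.U₁ D).card B.M with hU | hU
  · obtain ⟨C, hC⟩ := hD.exists_le_value h0 hAU hU hact
    refine ⟨A, _, C, hluc, ?_, hC⟩
    have hA : A = B.U₁ D := Finset.eq_of_subset_of_card_le hAU (by omega)
    -- Against the first entry of the minimum the shares of `λ` add up to `M λ`; against the second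
    -- the `h i` add up to `∑ h = M λ`, since `h` vanishes outside `U₁` and `U₂`.
    rw [← sub_le_iff_le_add', le_min_iff, Finset.sum_add_distrib, Finset.sum_const, nsmul_eq_mul]
    have h1 : 0 ≤ ∑ i ∈ A, D.h i := Finset.sum_nonneg fun i _ => hD.1.h_nonneg i
    have h2 : 0 ≤ (A.card : ℝ) * D.lam := mul_nonneg (Nat.cast_nonneg _) hD.1.lam_nonneg
    refine ⟨by linarith, ?_⟩
    rw [hD.1.balance, sum_h_eq hD.1, ← hA]
    linarith
  · refine ⟨A, 0, 0, hluc, ?_, fun T => by simpa using le_value_of_card_le h0 hact T⟩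
    have hA : A.card = B.M := by omega
    rw [Finset.sum_add_distrib, Finset.sum_const, nsmul_eq_mul, hA]
    have h1 : 0 ≤ ∑ i ∈ A, D.h i := Finset.sum_nonneg fun i _ => hD.1.h_nonneg i
    linarith

theorem Policy.average_nonneg (π : B.Policy) (s : ∀ i, Fin (K i)) (T : ℕ) :
    0 ≤ π.average s T :=
  div_nonneg (Policy.value_nonneg T) (Nat.cast_nonneg T)

theorem BalanceFeasible.eventually_average_le {D : DualSolution K} (hD : B.BalanceFeasible D)
    (π : B.Policy) (s : ∀ i, Fin (K i)) {ε : ℝ} (hε : 0 < ε) :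
    ∀ᶠ T in atTop, π.average s T ≤ B.balanceObj D + ε := by
  obtain ⟨C, hC⟩ := hD.exists_value_le π s
  filter_upwards [(tendsto_const_div_atTop_nhds_zero_nat C).eventually_lt_const hε,
    eventually_gt_atTop 0] with T h1 hT
  have hT' : (0 : ℝ) < T := by exact_mod_cast hT
  rw [div_lt_iff₀ hT'] at h1
  rw [Policy.average, div_le_iff₀ hT']
  linarith [hC T]

theorem BalanceFeasible.limsup_average_le {D : DualSolution K} (hD : B.BalanceFeasible D)
    (π : B.Policy) (s : ∀ i, Fin (K i)) :
    limsup (fun T : ℕ => π.average s T) atTop ≤ B.balanceObj D := by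
  refine le_of_forall_pos_le_add fun ε hε => ?_
  exact limsup_le_of_le
    (isBoundedUnder_of ⟨0, fun T => π.average_nonneg s T⟩).isCoboundedUnder_le
    (hD.eventually_average_le π s hε)

theorem BalanceOptimal.balanceObj_le {D : DualSolution K} (hD : B.BalanceOptimal D)
    {π : B.Policy} {s : ∀ i, Fin (K i)} (hπ : B.IsBalancedIndex D s π) :
    B.balanceObj D ≤ 2 * liminf (fun T : ℕ => π.average s T) atTop := by
  obtain ⟨A, w, C, hluc, hw, hval⟩ := hD.exists_rate hπ
  rw [hD.1.balanceObj_eq]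
  refine mul_le_mul_of_nonneg_left ?_ zero_le_two
  have hcob : IsCoboundedUnder (· ≥ ·) atTop fun T : ℕ => π.average s T :=
    IsBoundedUnder.isCoboundedUnder_ge
      ⟨B.balanceObj D + 1, eventually_map.2 (hD.1.eventually_average_le π s one_pos)⟩
  refine le_of_forall_pos_le_add fun ε hε => ?_
  -- One share of `ε` for each arm in `A` and one for `C / T`.
  have hδ : 0 < ε / (A.card + 1) := by positivity
  set δ := ε / (A.card + 1) with hδe
  have hδ1 : δ * (A.card + 1) = ε := by rw [hδe]; field_simp
  rw [← sub_le_iff_le_add]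
  refine le_liminf_of_le hcob ?_
  have hA : ∀ᶠ T : ℕ in atTop, ∀ i ∈ A,
      D.lam + D.h i - δ < B.repeatValue i T (s i) / (T : ℝ) := by
    refine (Filter.eventually_all_finset _).2 fun i hi => ?_
    refine eventually_lt_of_lt_liminf ?_ (isBoundedUnder_of ⟨0, fun T =>
      div_nonneg (B.repeatValue_nonneg i T (s i)) (Nat.cast_nonneg T)⟩)
    exact lt_of_lt_of_le (by linarith) (hluc i hi)
  filter_upwards [hA, (tendsto_const_div_atTop_nhds_zero_nat C).eventually_lt_const hδ,
    eventually_gt_atTop 0] with T h1 h2 hT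
  have hT' : (0 : ℝ) < T := by exact_mod_cast hT
  have h3 := Finset.sum_le_sum fun i hi => (h1 i hi).le
  rw [Finset.sum_sub_distrib, Finset.sum_const, nsmul_eq_mul, ← Finset.sum_div] at h3
  have h4 : (∑ i ∈ A, B.repeatValue i T (s i)) / T + w - C / T ≤ π.average s T := by
    rw [Policy.average, le_div_iff₀ hT']
    have := hval T
    field_simp
    linarith
  linarith

end MonotoneBandit
end
-- Existence of a balanced index policy
noncomputable section

namespace MonotoneBandit

variable {n : ℕ} {K : Fin n → ℕ} {B : MonotoneBandit n K}

/-! ### Existence of balanced index policies -/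

/-- Play all idle arms of `A` and all idle good arms, for which the invariant guarantees players,
and fill up with ready arms. -/
theorem IndexInvariant.exists_action {D : DualSolution K} {A : Finset (Fin n)}
    {c : BanditConfig K} (h : B.IndexInvariant D A c) (hAU : A ⊆ B.U₁ D) :
    ∃ a, B.Legal c a ∧ B.BalancedIndexAction D A c a := by
  classical
  let I := A.filter fun i => (c i).rem = 0
  have hI : ∀ i, i ∈ I ↔ i ∈ A ∧ (c i).rem = 0 := fun i => Finset.mem_filter
  have hIcard : I.card + (busy c).card = (busy c ∪ A).card := by
    rw [← Finset.card_union_of_disjoint]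
    · congr 1
      ext i
      by_cases hr : (c i).rem = 0 <;> simp [hI, busy, hr]
    · rw [Finset.disjoint_left]
      intro i hi
      exact not_mem_busy.2 ((hI i).1 hi).2
  have hU₂ : ∀ i ∈ A, i ∉ B.U₂ D := fun i hi =>
    Finset.disjoint_left.1 (disjoint_U₁_U₂ D) (hAU hi)
  rcases le_or_gt B.M (B.U₁ D).card with hU | hU
  · refine ⟨I, ⟨fun i hi => ((hI i).1 hi).2, ?_⟩, fun i hi hr => (hI i).2 ⟨hi, hr⟩,
      fun i hi => Or.inl ((hI i).1 hi).1, ?_, fun hlt => absurd hU (not_le.2 hlt)⟩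
    · have := h.card_le
      omega
    · rintro ⟨i, hi, hr⟩
      exact absurd hr.1 (hU₂ i ((hI i).1 hi).1)
  let G := Finset.univ.filter fun i => B.AvailGood D c i
  let R := Finset.univ.filter fun i => B.AvailReady D c i
  have hG : ∀ i, i ∈ G ↔ B.AvailGood D c i := fun i => by simp [G]
  have hR : ∀ i, i ∈ R ↔ B.AvailReady D c i := fun i => by simp [R]
  have hIG : Disjoint I G := Finset.disjoint_left.2 fun i hi hg =>
    hU₂ i ((hI i).1 hi).1 ((hG i).1 hg).1
  have hbG : Disjoint (busy c ∪ A) G := Finset.disjoint_left.2 fun i hi hg => by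
    rcases Finset.mem_union.1 hi with hb | hA
    · exact not_mem_busy.2 ((hG i).1 hg).2.1 hb
    · exact hU₂ i hA ((hG i).1 hg).1
  have hGcard : (busy c ∪ A).card + G.card ≤ B.M := by
    rw [← Finset.card_union_of_disjoint hbG]
    refine (Finset.card_le_card (Finset.union_subset_union le_rfl fun i hi => ?_)).trans
      (h.card_good_le hU)
    exact B.mem_goodArms.2 ⟨((hG i).1 hi).1, ((hG i).1 hi).2.2⟩
  obtain ⟨R', hR'R, hR'card⟩ := Finset.exists_subset_card_eq
    (s := R) (n := min R.card (B.M - ((busy c ∪ A).card + G.card))) (min_le_left _ _)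
  have hIGR : Disjoint (I ∪ G) R' := Finset.disjoint_left.2 fun i hi hr => by
    have hr := (hR i).1 (hR'R hr)
    rcases Finset.mem_union.1 hi with hi | hg
    · exact hU₂ i ((hI i).1 hi).1 hr.1
    · exact not_le.2 ((hG i).1 hg).2.2 hr.2.2.1
  have hcard : (I ∪ G ∪ R').card = I.card + G.card + R'.card := by
    rw [Finset.card_union_of_disjoint hIGR, Finset.card_union_of_disjoint hIG]
  refine ⟨I ∪ G ∪ R', ⟨fun i hi => ?_, by omega⟩, fun i hi hr => ?_, fun i hi => ?_,
    fun _ j hj => ?_, fun _ hlt j hj => ?_⟩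
  · simp only [Finset.mem_union] at hi
    rcases hi with (hi | hi) | hi
    · exact ((hI i).1 hi).2
    · exact ((hG i).1 hi).2.1
    · exact ((hR i).1 (hR'R hi)).2.1
  · exact Finset.mem_union_left _ (Finset.mem_union_left _ ((hI i).2 ⟨hi, hr⟩))
  · simp only [Finset.mem_union] at hi
    rcases hi with (hi | hi) | hi
    · exact Or.inl ((hI i).1 hi).1
    · exact Or.inr ⟨hU, Or.inl ((hG i).1 hi)⟩
    · exact Or.inr ⟨hU, Or.inr ((hR i).1 (hR'R hi))⟩
  · exact Finset.mem_union_left _ (Finset.mem_union_right _ ((hG j).2 hj))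
  · rcases hj with hj | hj
    · exact Finset.mem_union_left _ (Finset.mem_union_right _ ((hG j).2 hj))
    · have : R' = R := Finset.eq_of_subset_of_card_le hR'R (by omega)
      rw [this]
      exact Finset.mem_union_right _ ((hR j).2 hj)

/-- A state of least potential is never good. Started in such states, no arm of `U₂` is good, so the
limit on good arms at the start holds trivially. -/
theorem exists_deltaP_nonneg (B : MonotoneBandit n K) (D : DualSolution K) (i : Fin n) :
    ∃ k, 0 ≤ B.deltaP D i k := by
  have : Nonempty (Fin (K i)) := ⟨⟨0, B.K_pos i⟩⟩
  obtain ⟨k, hk⟩ := Finite.exists_min (D.p i)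
  exact ⟨k, Finset.sum_nonneg fun j _ => mul_nonneg (B.q_nonneg i k j) (sub_nonneg.2 (hk j))⟩

open Classical in
/-- Play by the rules of the balanced index policy whenever this is possible. -/
def indexPolicy (B : MonotoneBandit n K) (D : DualSolution K) (A : Finset (Fin n)) :
    B.Policy where
  law _ c := PMF.pure
    -- The empty action is always legal; it is a default for situations that violate the invariant,
    -- which are not reached from the chosen start.
    (if h : ∃ a, B.Legal c a ∧ B.BalancedIndexAction D A c a then h.choose else ∅)
  legal _ c a ha := by
    rw [← PMF.mem_support_iff, PMF.mem_support_pure_iff] at ha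
    subst ha
    split_ifs with h
    · exact h.choose_spec.1
    · exact ⟨by simp, by simp⟩

theorem action_of_indexPolicy {D : DualSolution K} {A : Finset (Fin n)} {c : BanditConfig K}
    (h : B.IndexInvariant D A c) (hAU : A ⊆ B.U₁ D) {H : BanditHistory K} {a : Finset (Fin n)}
    (ha : (B.indexPolicy D A).law H c a ≠ 0) : B.BalancedIndexAction D A c a := by
  have hex := h.exists_action hAU
  rw [← PMF.mem_support_iff, indexPolicy, PMF.mem_support_pure_iff, dif_pos hex] at ha
  rw [ha]
  exact hex.choose_spec.2

theorem exists_isBalancedIndex (B : MonotoneBandit n K) (D : DualSolution K) :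
    ∃ (s : ∀ i, Fin (K i)) (π : B.Policy), B.IsBalancedIndex D s π := by
  classical
  have hs : ∀ i, ∃ k, (i ∈ B.U₁ D → B.Lucrative D i k) ∧ (i ∉ B.U₁ D → 0 ≤ B.deltaP D i k) := by
    intro i
    by_cases hi : i ∈ B.U₁ D
    · obtain ⟨k, hk⟩ := (Finset.mem_filter.1 hi).2
      exact ⟨k, fun _ => hk, fun h => absurd hi h⟩
    · obtain ⟨k, hk⟩ := B.exists_deltaP_nonneg D i
      exact ⟨k, fun h => absurd h hi, fun _ => hk⟩
  choose s hs₁ hs₂ using hs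
  obtain ⟨A, hAU, hcard⟩ := Finset.exists_subset_card_eq (min_le_right B.M (B.U₁ D).card)
  have hgood : B.goodArms D (start s) = ∅ := by
    refine Finset.eq_empty_of_forall_notMem fun i hi => ?_
    obtain ⟨hi2, hg⟩ := B.mem_goodArms.1 hi
    exact not_le.2 hg (hs₂ i (Finset.disjoint_right.1 (disjoint_U₁_U₂ D) hi2))
  have hgood' : (B.U₁ D).card < B.M →
      (B.goodArms D (start s)).card ≤ B.M - (B.U₁ D).card := fun _ => by simp [hgood]
  have h0 : B.IndexInvariant D A (start s) := indexInvariant_start hcard hgood'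
  refine ⟨s, B.indexPolicy D A, A, hAU, hcard, fun i hi => hs₁ i (hAU hi), hgood',
    fun H c a hc ha => ?_⟩
  refine action_of_indexPolicy (hc.invariant h0 fun H c a s' hr hc ha => ?_) hAU ha
  exact hc.next ((B.indexPolicy D A).legal H c a ha) (action_of_indexPolicy hc hAU ha) s'

end MonotoneBandit
end

theorem mainTheorem7 {n : ℕ} {K : Fin n → ℕ} (B : MonotoneBandit n K) :
    (∃ D : DualSolution K, B.BalanceOptimal D) ∧
    ∀ D : DualSolution K, B.BalanceOptimal D →
      (∃ (s : ∀ i, Fin (K i)) (π : B.Policy), B.IsBalancedIndex D s π) ∧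
      ∀ (s : ∀ i, Fin (K i)) (π : B.Policy), B.IsBalancedIndex D s π →
        (∀ (s' : ∀ i, Fin (K i)) (π' : B.Policy),
          Filter.limsup (fun T : ℕ => π'.average s' T) Filter.atTop ≤
            2 * Filter.liminf (fun T : ℕ => π.average s T) Filter.atTop) ∧
        (∀ x : ∀ i, Fin (K i) → ℕ → ℝ, B.WhittleFeasible x →
          B.whittleObj x ≤ 2 * Filter.liminf (fun T : ℕ => π.average s T) Filter.atTop) :=
  ⟨B.exists_balanceOptimal, fun D hD => ⟨B.exists_isBalancedIndex D, fun _ _ hπ =>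
    ⟨fun s' π' => (hD.1.limsup_average_le π' s').trans (hD.balanceObj_le hπ),
      fun _ hx => (hD.1.whittleObj_le hx).trans (hD.balanceObj_le hπ)⟩⟩⟩
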